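/- Let $G$ be a (simple, undirected, possibly infinite) graph. A double ray in $G$ is a subgraph of $G$ isomorphic to the two-way infinite path, that is, to the graph with vertex set $\mathbb{Z}$ in which $i$ and $j$ are adjacent if and only if $|i-j|=1$. Suppose that for every $k\in\mathbb{N}$ there is a family of $k$ pairwise edge-disjoint double rays in $G$. Then there is an infinite family of pairwise edge-disjoint double rays in $G$. -/

import Mathlib

/-- The double ray, as an abstract graph: its vertices are the integers, and two integers are
adjacent precisely when they are consecutive. -/
def doubleRay : SimpleGraph ℤ where
  Adj i j := j = i + 1 ∨ i = j + 1
  symm := ⟨fun _ _ h => h.symm⟩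
  loopless := ⟨fun i h => by omega⟩

/-- `H.IsEdgeDisjointFamilyIn G D`: the family `D` consists of pairwise edge-disjoint subgraphs of
`G`, each of which is isomorphic to `H`. -/
def SimpleGraph.IsEdgeDisjointFamilyIn {W V ι : Type*} (H : SimpleGraph W) (G : SimpleGraph V)
    (D : ι → G.Subgraph) : Prop :=
  (∀ i, Nonempty (H ≃g (D i).coe)) ∧ ∀ i j, i ≠ j → Disjoint (D i).edgeSet (D j).edgeSet

/-- `G` has arbitrarily many edge-disjoint `H`: for every natural number `k` there is a family of
`k` edge-disjoint subgraphs of `G`, each isomorphic to `H`. -/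
def SimpleGraph.HasArbitrarilyManyEdgeDisjoint {W V : Type*} (G : SimpleGraph V)
    (H : SimpleGraph W) : Prop :=
  ∀ k : ℕ, ∃ D : Fin k → G.Subgraph, H.IsEdgeDisjointFamilyIn G D

/-- `G` has infinitely many edge-disjoint `H`: there is an infinite family of
edge-disjoint subgraphs of `G`, each isomorphic to `H`. -/
def SimpleGraph.HasInfinitelyManyEdgeDisjoint {W V : Type*} (G : SimpleGraph V)
    (H : SimpleGraph W) : Prop :=
  ∃ D : ℕ → G.Subgraph, H.IsEdgeDisjointFamilyIn G D

/-! The given finite packings use only countably many double rays in total. Keeping a tail of each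
of them in both directions, cut off late enough, yields a locally finite graph `H` whose edges lie
on these double rays (`exists_locallyFinite`). How fast the boundaries of finite vertex sets grow in
`H` decides between two arguments.

If the boundaries of all large finite sets exceed any given bound, Hall's theorem produces
infinitely many disjoint rays in `H` (`exists_disjoint_rays_of_boundary`). When they lie in
infinitely many components of `G`, each such component contributes a double ray. Otherwise
infinitely many of them lie in one component, and double rays can be joined out of them and removed
one at a time (`HasConnectedRays.infinitePacking`).

If arbitrarily large finite sets `U` have at most `d` boundary vertices, the part of a double ray
outside `U` matters to the inside only through finitely many data on the boundary: degrees,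
connections, and which boundary vertices have an infinite component. An ultrafilter gives every
double ray an eventual state, and by pigeonhole some state occurs in arbitrarily large packings
(`infinitePacking_of_boundary`). Outer parts with equal states are interchangeable (`isLinear_glue`,
`infinite_glue`). Hence `k` disjoint strands can be kept unchanged on a large finite set while their
outer parts are rerouted along unused double rays, and a further double ray is added that interferes
with at most `2 * d + 1` of those (`exists_new_strand`, `exists_extension`). The strands converge to
graphs of degrees zero and two with an infinite component, which contain double rays
(`infinitePacking_of_levels`). -/

namespace EdgeDisjointDoubleRays

variable {V : Type*}

/-! ### Rays and double rays as injective maps, and their edge graphs -/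

/-- The graph formed by the edges of a two-way infinite walk. -/
def trace (f : ℤ → V) : SimpleGraph V :=
  SimpleGraph.fromRel fun a b => ∃ n, f n = a ∧ f (n + 1) = b

/-- `f` is a double ray in `K`. -/
structure IsDoubleRay (K : SimpleGraph V) (f : ℤ → V) : Prop where
  inj : Function.Injective f
  adj : ∀ n, K.Adj (f n) (f (n + 1))

/-- `r` is a ray in `K`. -/
structure IsRay (K : SimpleGraph V) (r : ℕ → V) : Prop where
  inj : Function.Injective r
  adj : ∀ n, K.Adj (r n) (r (n + 1))

/-- There is an infinite family of edge-disjoint double rays in `K`. -/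
def InfinitePacking (K : SimpleGraph V) : Prop :=
  ∃ F : ℕ → ℤ → V, (∀ i, IsDoubleRay K (F i)) ∧
    ∀ i j, i ≠ j → Disjoint (trace (F i)) (trace (F j))

theorem disjoint_iff_adj {A B : SimpleGraph V} :
    Disjoint A B ↔ ∀ a b, A.Adj a b → ¬ B.Adj a b := by
  rw [disjoint_iff_inf_le]
  constructor
  · intro h a b ha hb
    exact h (show (A ⊓ B).Adj a b from ⟨ha, hb⟩)
  · intro h a b hab
    exact (h a b hab.1 hab.2).elim

theorem IsDoubleRay.mono {K L : SimpleGraph V} {f : ℤ → V} (h : IsDoubleRay K f) (hKL : K ≤ L) :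
    IsDoubleRay L f :=
  ⟨h.inj, fun n => hKL (h.adj n)⟩

theorem IsRay.mono {K L : SimpleGraph V} {r : ℕ → V} (h : IsRay K r) (hKL : K ≤ L) :
    IsRay L r :=
  ⟨h.inj, fun n => hKL (h.adj n)⟩

theorem IsRay.tail {K : SimpleGraph V} {r : ℕ → V} (h : IsRay K r) (c : ℕ) :
    IsRay K fun n => r (n + c) :=
  ⟨fun a b hab => by simpa using h.inj hab, fun n => by
    have := h.adj (n + c)
    rwa [show n + c + 1 = n + 1 + c by omega] at this⟩

theorem IsRay.reachable {K : SimpleGraph V} {r : ℕ → V} (h : IsRay K r) (m n : ℕ) :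
    K.Reachable (r m) (r n) := by
  have key : ∀ n, K.Reachable (r 0) (r n) := by
    intro n
    induction n with
    | zero => exact SimpleGraph.Reachable.refl _
    | succ n ih => exact ih.trans (h.adj n).reachable
  exact (key m).symm.trans (key n)

theorem InfinitePacking.mono {K L : SimpleGraph V} (h : InfinitePacking K) (hKL : K ≤ L) :
    InfinitePacking L := by
  obtain ⟨F, hF, hd⟩ := h
  exact ⟨F, fun i => (hF i).mono hKL, hd⟩

theorem trace_adj {f : ℤ → V} (hf : Function.Injective f) {a b : V} :
    (trace f).Adj a b ↔ ∃ n, (f n = a ∧ f (n + 1) = b) ∨ (f n = b ∧ f (n + 1) = a) := by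
  simp only [trace, SimpleGraph.fromRel_adj, exists_or]
  constructor
  · exact fun h => h.2
  · intro h
    refine ⟨?_, h⟩
    rcases h with ⟨n, rfl, rfl⟩ | ⟨n, rfl, rfl⟩
    · intro h; have := hf h; omega
    · intro h; have := hf h; omega

theorem isDoubleRay_trace {f : ℤ → V} (hf : Function.Injective f) : IsDoubleRay (trace f) f :=
  ⟨hf, fun n => (trace_adj hf).2 ⟨n, Or.inl ⟨rfl, rfl⟩⟩⟩

theorem IsDoubleRay.trace_le {K : SimpleGraph V} {f : ℤ → V} (h : IsDoubleRay K f) :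
    trace f ≤ K := by
  intro a b hab
  obtain ⟨n, ⟨rfl, rfl⟩ | ⟨rfl, rfl⟩⟩ := (trace_adj h.inj).1 hab
  · exact h.adj n
  · exact (h.adj n).symm

theorem trace_adj_apply {f : ℤ → V} (hf : Function.Injective f) {n : ℤ} {b : V} :
    (trace f).Adj (f n) b ↔ b = f (n - 1) ∨ b = f (n + 1) := by
  rw [trace_adj hf]
  constructor
  · rintro ⟨m, ⟨h1, h2⟩ | ⟨h1, h2⟩⟩
    · right; rw [← h2, hf h1]
    · left; rw [← h1, ← hf h2]; congr 1; omega
  · rintro (rfl | rfl)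
    · exact ⟨n - 1, Or.inr ⟨rfl, by congr 1; omega⟩⟩
    · exact ⟨n, Or.inl ⟨rfl, rfl⟩⟩

theorem mem_range_of_trace_adj {f : ℤ → V} (hf : Function.Injective f) {a b : V}
    (h : (trace f).Adj a b) : a ∈ Set.range f := by
  obtain ⟨n, ⟨rfl, rfl⟩ | ⟨rfl, rfl⟩⟩ := (trace_adj hf).1 h
  · exact ⟨_, rfl⟩
  · exact ⟨_, rfl⟩

theorem IsDoubleRay.right {K : SimpleGraph V} {f : ℤ → V} (h : IsDoubleRay K f) (c : ℤ) :
    IsRay K fun n : ℕ => f (c + n) :=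
  ⟨fun a b hab => by simpa using h.inj hab, fun n => by
    have := h.adj (c + n)
    rwa [add_assoc] at this⟩

theorem IsDoubleRay.neg {K : SimpleGraph V} {f : ℤ → V} (h : IsDoubleRay K f) :
    IsDoubleRay K fun n => f (-n) :=
  ⟨fun a b hab => by simpa using h.inj hab, fun n => by
    have := (h.adj (-n - 1)).symm
    rwa [show -n - 1 + 1 = -n by omega, show -n - 1 = -(n + 1) by omega] at this⟩

theorem IsDoubleRay.reachable {K : SimpleGraph V} {f : ℤ → V} (h : IsDoubleRay K f) (m n : ℤ) :
    K.Reachable (f m) (f n) := by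
  have key : ∀ m : ℤ, ∀ k : ℕ, K.Reachable (f m) (f (m + k)) := fun m k => by
    simpa using (h.right m).reachable 0 k
  rcases le_total m n with hmn | hmn
  · have := key m (n - m).toNat
    rwa [show m + ((n - m).toNat : ℤ) = n by omega] at this
  · have := key n (m - n).toNat
    rw [show n + ((m - n).toNat : ℤ) = m by omega] at this
    exact this.symm

theorem trace_neg {f : ℤ → V} (hf : Function.Injective f) :
    trace (fun n => f (-n)) = trace f := by
  have h := isDoubleRay_trace hf
  refine le_antisymm h.neg.trace_le ?_
  simpa using (isDoubleRay_trace h.neg.inj).neg.trace_le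

/-! ### Passing between maps `ℤ → V` and subgraphs isomorphic to the double ray -/

/-- The subgraph of `G` formed by a double ray. -/
def IsDoubleRay.toSubgraph {G : SimpleGraph V} {f : ℤ → V} (h : IsDoubleRay G f) :
    G.Subgraph where
  verts := Set.range f
  Adj := (trace f).Adj
  adj_sub := fun hab => h.trace_le hab
  edge_vert := fun hab => mem_range_of_trace_adj h.inj hab
  symm := (trace f).symm

theorem IsDoubleRay.nonempty_iso {G : SimpleGraph V} {f : ℤ → V} (h : IsDoubleRay G f) :
    Nonempty (doubleRay ≃g h.toSubgraph.coe) := by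
  refine ⟨⟨Equiv.ofInjective f h.inj, ?_⟩⟩
  intro m n
  change (trace f).Adj (f m) (f n) ↔ _
  rw [trace_adj_apply h.inj, h.inj.eq_iff, h.inj.eq_iff]
  change _ ↔ n = m + 1 ∨ m = n + 1
  omega

theorem exists_isDoubleRay_of_iso {G : SimpleGraph V} {D : G.Subgraph}
    (e : doubleRay ≃g D.coe) :
    ∃ f, IsDoubleRay G f ∧ ∀ a b, (trace f).Adj a b → D.Adj a b := by
  have hinj : Function.Injective fun n => (e n : V) :=
    Subtype.val_injective.comp e.injective
  have hadj : ∀ n, D.Adj (e n) (e (n + 1)) := fun n =>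
    e.map_rel_iff.2 (show doubleRay.Adj n (n + 1) from Or.inl rfl)
  refine ⟨fun n => (e n : V), ⟨hinj, fun n => (hadj n).adj_sub⟩, fun a b hab => ?_⟩
  obtain ⟨n, ⟨rfl, rfl⟩ | ⟨rfl, rfl⟩⟩ := (trace_adj hinj).1 hab
  · exact hadj n
  · exact (hadj n).symm

theorem InfinitePacking.hasInfinitelyMany {G : SimpleGraph V} (h : InfinitePacking G) :
    G.HasInfinitelyManyEdgeDisjoint doubleRay := by
  obtain ⟨F, hF, hd⟩ := h
  refine ⟨fun i => (hF i).toSubgraph, fun i => (hF i).nonempty_iso, fun i j hij => ?_⟩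
  rw [Set.disjoint_left]
  intro e
  induction e with
  | h a b => exact fun ha hb => disjoint_iff_adj.1 (hd i j hij) a b ha hb

theorem exists_packing {G : SimpleGraph V} (hG : G.HasArbitrarilyManyEdgeDisjoint doubleRay)
    (k : ℕ) : ∃ f : Fin k → ℤ → V, (∀ i, IsDoubleRay G (f i)) ∧
      ∀ i j, i ≠ j → Disjoint (trace (f i)) (trace (f j)) := by
  obtain ⟨D, hD, hd⟩ := hG k
  choose f hf hfD using fun i => exists_isDoubleRay_of_iso (hD i).some
  refine ⟨f, hf, fun i j hij => disjoint_iff_adj.2 fun a b ha hb => ?_⟩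
  exact Set.disjoint_left.1 (hd i j hij) (show s(a, b) ∈ (D i).edgeSet from hfD i a b ha)
    (hfD j a b hb)

/-! ### Joining rays -/

/-- The rays `q` and `r` have a common tail. -/
def SameTail (q r : ℕ → V) : Prop := ∃ a b, ∀ n, q (n + a) = r (n + b)

/-- Prepend the vertices of the walk to `r`, starting from its end. A vertex already on the current
ray cuts the ray off there, and the first vertex met in `Λ` ends the construction. -/
theorem exists_ray_of_walk {K : SimpleGraph V} {Λ : Set V} {r : ℕ → V} (hr : IsRay K r)
    (hΛ : ∀ n, r n ∉ Λ) {x y : V} (w : K.Walk x y) (hy : y = r 0) :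
    (∃ q, IsRay K q ∧ q 0 ∈ Λ ∧ (∀ n, q (n + 1) ∉ Λ) ∧ SameTail q r) ∨
      ∃ q, IsRay K q ∧ q 0 = x ∧ (∀ n, q n ∉ Λ) ∧ SameTail q r := by
  induction w with
  | nil => exact Or.inr ⟨r, hr, hy.symm, hΛ, 0, 0, fun n => rfl⟩
  | @cons x z y hxz w ih =>
    rcases ih hy with h | ⟨q, hq, hq0, hqΛ, a, b, hab⟩
    · exact Or.inl h
    by_cases hx : ∃ k, q k = x
    · obtain ⟨k, rfl⟩ := hx
      refine Or.inr ⟨fun n => q (n + k), hq.tail k, by simp, fun n => hqΛ _, a, b + k, fun n => ?_⟩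
      have := hab (n + k)
      dsimp only
      rw [show n + a + k = n + k + a by omega, this]
      congr 1; omega
    · push Not at hx
      let p : ℕ → V := fun n => Nat.casesOn n x q
      have hp : IsRay K p := by
        refine ⟨?_, ?_⟩
        · rintro (_ | m) (_ | n) h
          · rfl
          · exact (hx n h.symm).elim
          · exact (hx m h).elim
          · exact congrArg _ (hq.inj h)
        · rintro (_ | n)
          · change K.Adj x (q 0)
            rwa [hq0]
          · exact hq.adj n
      have ht : SameTail p r := ⟨a + 1, b, hab⟩
      by_cases hxΛ : x ∈ Λ
      · exact Or.inl ⟨p, hp, hxΛ, hqΛ, ht⟩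
      · refine Or.inr ⟨p, hp, rfl, ?_, ht⟩
        rintro (_ | n)
        · exact hxΛ
        · exact hqΛ n

theorem exists_ray_from_set {K : SimpleGraph V} {Λ : Set V} {r : ℕ → V} (hr : IsRay K r)
    (hΛ : ∀ n, r n ∉ Λ) {x : V} (hx : x ∈ Λ) (h : K.Reachable x (r 0)) :
    ∃ q, IsRay K q ∧ q 0 ∈ Λ ∧ (∀ n, q (n + 1) ∉ Λ) ∧ SameTail q r := by
  obtain ⟨w⟩ := h
  rcases exists_ray_of_walk hr hΛ w rfl with h | ⟨q, -, h0, h1, -⟩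
  · exact h
  · exact (h1 0 (h0 ▸ hx)).elim

theorem exists_isDoubleRay_of_rays {K : SimpleGraph V} {r s : ℕ → V} (hr : IsRay K r)
    (hs : IsRay K s) (hrs : ∀ m n, r m ≠ s n) (h : K.Reachable (s 0) (r 0)) :
    ∃ f, IsDoubleRay K f ∧ SameTail (fun n : ℕ => f n) r ∧ SameTail (fun n : ℕ => f (-n)) s := by
  obtain ⟨q, hq, ⟨c, hc⟩, hqs, hqr⟩ := exists_ray_from_set (Λ := Set.range s) hr
    (fun n ⟨m, hm⟩ => hrs n m hm.symm) ⟨0, rfl⟩ h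
  -- The ray `q` leaves `s` at index `c` for good, so the initial segment of `s` before `c` is
  -- dropped.
  let f : ℤ → V := fun n => if 0 ≤ n then q n.toNat else s ((-n).toNat + c)
  have hfpos : ∀ n : ℕ, f n = q n := fun n => by simp [f]
  have hfneg : ∀ n : ℕ, f (-n) = s (n + c) := fun n => by
    rcases Nat.eq_zero_or_pos n with rfl | hn
    · simp [f, hc]
    · have : ¬ (0 ≤ -(n : ℤ)) := by omega
      simp only [f, if_neg this]
      congr 1; omega
  refine ⟨f, ⟨?_, ?_⟩, ?_, ⟨0, c, hfneg⟩⟩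
  · have key : ∀ m n : ℕ, f m = f (-n) → (m : ℤ) = -n := by
      intro m n h
      rw [hfpos, hfneg] at h
      rcases m with _ | m
      · rw [← hc] at h
        have := hs.inj h
        omega
      · exact (hqs m ⟨_, h.symm⟩).elim
    intro m n hmn
    obtain ⟨m, rfl | rfl⟩ := m.eq_nat_or_neg <;> obtain ⟨n, rfl | rfl⟩ := n.eq_nat_or_neg
    · rw [hfpos, hfpos] at hmn
      rw [hq.inj hmn]
    · exact key m n hmn
    · exact (key n m hmn.symm).symm
    · rw [hfneg, hfneg] at hmn
      have := hs.inj hmn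
      omega
  · intro n
    rcases le_or_gt 0 n with hn | hn
    · lift n to ℕ using hn
      rw [hfpos, show (n : ℤ) + 1 = (n + 1 : ℕ) by simp, hfpos]
      exact hq.adj n
    · obtain ⟨m, rfl⟩ : ∃ m : ℕ, n = -(m + 1 : ℕ) := ⟨(-n - 1).toNat, by omega⟩
      rw [hfneg, show -((m + 1 : ℕ) : ℤ) + 1 = -(m : ℤ) by push_cast; ring, hfneg]
      have := (hs.adj (m + c)).symm
      rwa [show m + c + 1 = m + 1 + c by omega] at this
  · obtain ⟨a, b, hab⟩ := hqr
    exact ⟨a, b, fun n => by dsimp only; rw [hfpos, hab]⟩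

/-! ### Graphs all of whose degrees are zero or two -/

/-- Every vertex of `D` has degree zero or two. -/
def IsLinear (D : SimpleGraph V) : Prop :=
  ∀ v, D.neighborSet v = ∅ ∨ (D.neighborSet v).ncard = 2

theorem IsLinear.finite {D : SimpleGraph V} (h : IsLinear D) (v : V) :
    (D.neighborSet v).Finite := by
  rcases h v with h | h
  · simp [h]
  · exact Set.finite_of_ncard_ne_zero (by omega)

theorem IsLinear.ncard_le {D : SimpleGraph V} (h : IsLinear D) (v : V) :
    (D.neighborSet v).ncard ≤ 2 := by
  rcases h v with h | h
  · simp [h]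
  · exact h.le

theorem isLinear_trace {f : ℤ → V} (hf : Function.Injective f) : IsLinear (trace f) := by
  intro v
  by_cases hv : v ∈ Set.range f
  · right
    obtain ⟨n, rfl⟩ := hv
    have : (trace f).neighborSet (f n) = {f (n - 1), f (n + 1)} := by
      ext b
      simp [trace_adj_apply hf]
    rw [this, Set.ncard_pair]
    intro h
    have := hf h
    omega
  · left
    ext b
    simp only [SimpleGraph.mem_neighborSet, Set.mem_empty_iff_false, iff_false]
    exact fun h => hv (mem_range_of_trace_adj hf h)

theorem IsLinear.exists_other {D : SimpleGraph V} (h : IsLinear D) {w u : V} (hwu : D.Adj w u) :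
    ∃ x, D.Adj w x ∧ x ≠ u ∧ ∀ y, D.Adj w y → y = u ∨ y = x := by
  rcases h w with h | h
  · exact (Set.notMem_empty u (h ▸ hwu)).elim
  · obtain ⟨a, b, hab, hw⟩ := Set.ncard_eq_two.1 h
    have hmem : ∀ y, D.Adj w y ↔ y = a ∨ y = b := fun y => by
      rw [← SimpleGraph.mem_neighborSet, hw]; simp
    rcases (hmem u).1 hwu with rfl | rfl
    · exact ⟨b, (hmem b).2 (Or.inr rfl), hab.symm, fun y hy => (hmem y).1 hy⟩
    · exact ⟨a, (hmem a).2 (Or.inl rfl), hab, fun y hy => ((hmem y).1 hy).symm⟩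

theorem IsLinear.exists_walk {D : SimpleGraph V} (h : IsLinear D) {v a : V} (hva : D.Adj v a) :
    ∃ f : ℤ → V, f 0 = v ∧ (∀ n, D.Adj (f n) (f (n + 1))) ∧ (∀ n, f (n + 1) ≠ f (n - 1)) ∧
      ∀ n x, D.Adj (f n) x → x = f (n - 1) ∨ x = f (n + 1) := by
  choose oth hadj hne hall using fun w u (hwu : D.Adj w u) => h.exists_other hwu
  have hinv : ∀ w u (hwu : D.Adj w u), oth w (oth w u hwu) (hadj w u hwu) = u := by
    intro w u hwu
    rcases hall w u hwu _ (hadj w _ (hadj w u hwu)) with h | h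
    · exact h
    · exact (hne w _ (hadj w u hwu) h).elim
  have hcongr : ∀ w u u' (hwu : D.Adj w u) (hwu' : D.Adj w u'), u = u' →
      oth w u hwu = oth w u' hwu' := by
    intro w u u' hwu hwu' h; subst h; rfl
  -- On directed edges, moving on to the next edge is invertible, so its integer powers give a
  -- two-way walk at once.
  let Dt := {p : V × V // D.Adj p.1 p.2}
  let φ : Equiv.Perm Dt :=
    { toFun := fun p => ⟨(p.1.2, oth p.1.2 p.1.1 p.2.symm), hadj _ _ _⟩
      invFun := fun p => ⟨(oth p.1.1 p.1.2 p.2, p.1.1), (hadj _ _ _).symm⟩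
      left_inv := fun p => Subtype.ext (Prod.ext (hinv _ _ _) rfl)
      right_inv := fun p => Subtype.ext (Prod.ext rfl (hinv _ _ _)) }
  let d : ℤ → Dt := fun n => (φ ^ n) ⟨(v, a), hva⟩
  have hd : ∀ n, d (n + 1) = φ (d n) := fun n => by
    simp only [d, add_comm n 1, zpow_add, zpow_one, Equiv.Perm.mul_apply]
  let f : ℤ → V := fun n => (d n).1.1
  have hsnd : ∀ n, (d n).1.2 = f (n + 1) := fun n => by
    simp only [f, hd]; rfl
  have hf : ∀ n, D.Adj (f n) (f (n + 1)) := fun n => by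
    rw [← hsnd]; exact (d n).2
  have hoth : ∀ n, f (n + 1) = oth (f n) (f (n - 1))
      (by have := (hf (n - 1)).symm; rwa [sub_add_cancel] at this) := by
    intro n
    have h1 : d n = φ (d (n - 1)) := by rw [← hd, sub_add_cancel]
    have h2 : (d (n - 1)).1.2 = f n := by rw [hsnd, sub_add_cancel]
    rw [← hsnd, h1]
    change oth (d (n - 1)).1.2 (d (n - 1)).1.1 _ = _
    congr 1
  refine ⟨f, rfl, hf, fun n => ?_, fun n x hx => ?_⟩
  · rw [hoth]; exact hne _ _ _
  · have := hall (f n) (f (n - 1)) (by have := (hf (n - 1)).symm; rwa [sub_add_cancel] at this) x hx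
    rwa [← hoth] at this

/-- The non-backtracking walk through `v` covers its component. A repeated vertex would make the
walk either fold back on itself or run periodically, and the latter is impossible in an infinite
component. -/
theorem IsLinear.exists_isDoubleRay {D : SimpleGraph V} (h : IsLinear D) {v : V}
    (hv : {w | D.Reachable v w}.Infinite) : ∃ f, IsDoubleRay D f := by
  obtain ⟨a, hva⟩ : ∃ a, D.Adj v a := by
    by_contra! hno
    refine hv ((Set.finite_singleton v).subset ?_)
    rintro w ⟨p⟩
    cases p with
    | nil => rfl
    | cons hadj _ => exact (hno _ hadj).elim
  obtain ⟨f, hf0, hf, hne, hall⟩ := h.exists_walk hva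
  refine ⟨f, ?_, hf⟩
  have hrange : {w | D.Reachable v w} ⊆ Set.range f := by
    rintro w ⟨p⟩
    have key : ∀ x y (p : D.Walk x y), x ∈ Set.range f → y ∈ Set.range f := by
      intro x y p
      induction p with
      | nil => exact id
      | cons hadj _ ih =>
        rintro ⟨n, rfl⟩
        rcases hall n _ hadj with h | h
        · exact ih ⟨_, h.symm⟩
        · exact ih ⟨_, h.symm⟩
    exact key v w p ⟨0, hf0⟩
  have hinf : (Set.range f).Infinite := hv.mono hrange
  have key : ∀ i j, i < j → f i ≠ f j := by
    intro i j hij hfij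
    have hn1 := hf i
    rw [hfij] at hn1
    rcases hall j _ hn1 with h1 | h1
    -- Here the walk is symmetric about the midpoint of `i` and `j`, where it would have to
    -- backtrack or use a loop, according to the parity of `j - i`.
    · have hrev : ∀ k : ℕ, f (i + k) = f (j - k) ∧ f (i + k + 1) = f (j - k - 1) := by
        intro k
        induction k with
        | zero => simpa using ⟨hfij, h1⟩
        | succ k ih =>
          obtain ⟨ih1, ih2⟩ := ih
          push_cast
          rw [← add_assoc, show j - ((k : ℤ) + 1) = j - k - 1 by ring]
          refine ⟨ih2, ?_⟩
          have := hf (i + k + 1)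
          rw [ih2] at this
          rcases hall _ _ this with h | h
          · exact h
          · rw [sub_add_cancel, ← ih1] at h
            exact (hne (i + k + 1) (by rw [h]; congr 1; ring)).elim
      obtain ⟨k, hk | hk⟩ : ∃ k : ℕ, j = i + 2 * k ∨ j = i + 2 * k + 1 :=
        ⟨((j - i) / 2).toNat, by omega⟩
      · have := (hrev k).2
        rw [show j - (k : ℤ) - 1 = i + k - 1 by omega] at this
        exact hne _ this
      · have := (hrev k).1
        rw [show j - (k : ℤ) = i + k + 1 by omega] at this
        exact (hf (i + k)).ne this
    · have hper : ∀ k : ℤ, f (i + k) = f (j + k) ∧ f (i + k + 1) = f (j + k + 1) := by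
        intro k
        induction k with
        | zero => simpa using ⟨hfij, h1⟩
        | succ k ih =>
          obtain ⟨ih1, ih2⟩ := ih
          rw [← add_assoc, ← add_assoc]
          refine ⟨ih2, ?_⟩
          have := hf (i + k + 1)
          rw [ih2] at this
          rcases hall _ _ this with h | h
          · exact (hne (i + k + 1) (by
              rw [h, add_sub_cancel_right, add_sub_cancel_right, ih1])).elim
          · exact h
        | pred k ih =>
          obtain ⟨ih1, ih2⟩ := ih
          rw [show i + (-(k : ℤ) - 1) + 1 = i + -k by ring,
            show j + (-(k : ℤ) - 1) + 1 = j + -k by ring,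
            show i + (-(k : ℤ) - 1) = i + -k - 1 by ring,
            show j + (-(k : ℤ) - 1) = j + -k - 1 by ring]
          refine ⟨?_, ih1⟩
          have := (hf (i + -k - 1)).symm
          rw [sub_add_cancel, ih1] at this
          rcases hall _ _ this with h | h
          · exact h
          · exact (hne (i + -k) (by rw [h, ih2])).elim
      refine hinf (((Set.finite_Ico (0 : ℤ) (j - i)).image f).subset ?_)
      have hp : ∀ n, f (n + (j - i)) = f n := fun n => by
        have := (hper (n - i)).1
        rw [show i + (n - i) = n by ring, show j + (n - i) = n + (j - i) by ring] at this
        exact this.symm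
      rintro _ ⟨n, rfl⟩
      refine ⟨n % (j - i), ⟨Int.emod_nonneg _ (by omega), Int.emod_lt_of_pos _ (by omega)⟩, ?_⟩
      have hmul : ∀ (k : ℤ) n, f (n + (j - i) * k) = f n := by
        intro k
        induction k with
        | zero => simp
        | succ k ih => intro n; rw [mul_add, mul_one, ← add_assoc, hp, ih]
        | pred k ih =>
          intro n
          rw [← hp, mul_sub, mul_one, ← ih n]
          congr 1; ring
      rw [← hmul (n / (j - i)), Int.emod_add_mul_ediv]
  intro i j hfij
  rcases lt_trichotomy i j with h | h | h
  · exact (key i j h hfij).elim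
  · exact h
  · exact (key j i h hfij.symm).elim

/-! ### Infinitely many disjoint rays from large boundaries -/

/-- The vertices outside `U` with a neighbour in `U`. -/
def boundary (H : SimpleGraph V) (U : Finset V) : Set V :=
  {w | w ∉ U ∧ ∃ u ∈ U, H.Adj u w}

theorem finite_boundary {H : SimpleGraph V} (hH : ∀ v, (H.neighborSet v).Finite)
    (U : Finset V) : (boundary H U).Finite := by
  refine (U.finite_toSet.biUnion fun u _ => hH u).subset ?_
  rintro w ⟨-, u, hu, huw⟩
  exact Set.mem_biUnion hu huw

/-- Hall's theorem gives an injection `s` moving each vertex to itself or a neighbour, together with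
infinitely many distinct vertices `a j` outside the range of `s`. The orbits of the `a j` under `s`
are then disjoint and never repeat a vertex, so they are rays. -/
theorem exists_disjoint_rays_of_boundary {H : SimpleGraph V}
    (hH : ∀ v, (H.neighborSet v).Finite)
    (h : ∀ d, ∃ U : Finset V, ∀ T : Finset V, U ⊆ T → d < (boundary H T).ncard) :
    ∃ r : ℕ → ℕ → V, (∀ i, IsRay H (r i)) ∧ ∀ i j m n, i ≠ j → r i m ≠ r j n := by
  classical
  choose U hU using h
  let N : V → Finset V := fun v => insert v (hH v).toFinset
  have hN : ∀ T : Finset V, (T.biUnion N).card = T.card + (boundary H T).ncard := by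
    intro T
    have : T.biUnion N = T ∪ (finite_boundary hH T).toFinset := by
      ext w
      simp only [N, Finset.mem_biUnion, Finset.mem_insert, Set.Finite.mem_toFinset,
        SimpleGraph.mem_neighborSet, Finset.mem_union, boundary, Set.mem_ofPred_eq]
      constructor
      · rintro ⟨u, hu, rfl | huw⟩
        · exact Or.inl hu
        · by_cases hw : w ∈ T
          · exact Or.inl hw
          · exact Or.inr ⟨hw, u, hu, huw⟩
      · rintro (hw | ⟨-, u, hu, huw⟩)
        · exact ⟨w, hw, Or.inl rfl⟩
        · exact ⟨u, hu, Or.inr huw⟩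
    rw [this, Finset.card_union_of_disjoint, Set.ncard_eq_toFinset_card _ (finite_boundary hH T)]
    rw [Finset.disjoint_left]
    intro w hw hw'
    exact ((Set.Finite.mem_toFinset _).1 hw').1 hw
  -- Using the union of `U 0, …, U j` makes the extra demands nested. In Hall's condition only the
  -- largest one, `j`, counts: a boundary of more than `j` vertices pays for the at most `j + 1`
  -- demands.
  let t : V ⊕ ℕ → Finset V := Sum.elim N
    fun j => ((Finset.range (j + 1)).biUnion U).biUnion N
  obtain ⟨e, he, het⟩ := (Finset.all_card_le_biUnion_card_iff_exists_injective t).1 (by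
    intro s
    have hs := Finset.card_toLeft_add_card_toRight (u := s)
    set T := s.toLeft with hT
    set I := s.toRight with hI
    have hTs : T.biUnion N ⊆ s.biUnion t := by
      intro w hw
      obtain ⟨u, hu, huw⟩ := Finset.mem_biUnion.1 hw
      exact Finset.mem_biUnion.2 ⟨Sum.inl u, Finset.mem_toLeft.1 hu, huw⟩
    rcases I.eq_empty_or_nonempty with hIe | hIn
    · rw [hIe, Finset.card_empty, add_zero] at hs
      rw [← hs]
      refine le_trans ?_ (Finset.card_le_card hTs)
      rw [hN]; omega
    · set j := I.max' hIn
      have hj : j ∈ I := I.max'_mem hIn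
      set W := (Finset.range (j + 1)).biUnion U
      have hcard : I.card ≤ j + 1 := by
        have : I ⊆ Finset.range (j + 1) := fun i hi => by
          have := I.le_max' i hi
          simp only [Finset.mem_range]; omega
        simpa using Finset.card_le_card this
      have hsub : (T ∪ W).biUnion N ⊆ s.biUnion t := by
        rw [Finset.union_biUnion]
        refine Finset.union_subset hTs ?_
        intro w hw
        exact Finset.mem_biUnion.2 ⟨Sum.inr j, Finset.mem_toRight.1 hj, hw⟩
      have hb := hU j (T ∪ W) (fun u hu => Finset.mem_union_right _
        (Finset.mem_biUnion.2 ⟨j, by simp, hu⟩))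
      have h1 := Finset.card_le_card hsub
      rw [hN] at h1
      have h2 := Finset.card_le_card (Finset.subset_union_left (s₁ := T) (s₂ := W))
      omega)
  let s : V → V := fun v => e (Sum.inl v)
  let a : ℕ → V := fun j => e (Sum.inr j)
  have hs : Function.Injective s := fun x y hxy => by simpa using he hxy
  have ha : Function.Injective a := fun x y hxy => by simpa using he hxy
  have hsa : ∀ v j, s v ≠ a j := fun v j h => by simpa using he h
  have hmn : ∀ i j m n, s^[m] (a i) = s^[n] (a j) → i = j ∧ m = n := by
    intro i j m
    induction m with
    | zero =>
      rintro (_ | n) h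
      · exact ⟨ha h, rfl⟩
      · rw [Function.iterate_succ_apply'] at h
        exact (hsa _ _ h.symm).elim
    | succ m ih =>
      rintro (_ | n) h
      · rw [Function.iterate_succ_apply'] at h
        exact (hsa _ _ h).elim
      · rw [Function.iterate_succ_apply', Function.iterate_succ_apply'] at h
        obtain ⟨h1, h2⟩ := ih n (hs h)
        exact ⟨h1, by rw [h2]⟩
  refine ⟨fun i n => s^[n] (a i), fun i => ⟨fun m n h => (hmn i i m n h).2, fun n => ?_⟩,
    fun i j m n hij h => hij (hmn i j m n h).1⟩
  have hmem : s (s^[n] (a i)) ∈ N (s^[n] (a i)) := het (Sum.inl (s^[n] (a i)))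
  rw [← Function.iterate_succ_apply' s] at hmem
  rcases Finset.mem_insert.1 hmem with h | h
  · have := (hmn i i _ _ h).2
    omega
  · simpa using h

/-! ### Infinitely many disjoint rays in a connected graph -/

/-- There are infinitely many disjoint rays in the same component of `K`. -/
def HasConnectedRays (K : SimpleGraph V) : Prop :=
  ∃ r : ℕ → ℕ → V, (∀ i, IsRay K (r i)) ∧ (∀ i j m n, i ≠ j → r i m ≠ r j n) ∧
    ∀ i j, K.Reachable (r i 0) (r j 0)

/-- The graph formed by the edges of a one-way infinite walk. -/
def rayTrace (q : ℕ → V) : SimpleGraph V :=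
  SimpleGraph.fromRel fun a b => ∃ n, q n = a ∧ q (n + 1) = b

theorem isRay_rayTrace {K : SimpleGraph V} {q : ℕ → V} (hq : IsRay K q) : IsRay (rayTrace q) q :=
  ⟨hq.inj, fun n => (SimpleGraph.fromRel_adj _ _ _).2 ⟨(hq.adj n).ne, Or.inl ⟨n, rfl, rfl⟩⟩⟩

theorem IsRay.rayTrace_le {K : SimpleGraph V} {q : ℕ → V} (hq : IsRay K q) : rayTrace q ≤ K := by
  intro a b hab
  rcases ((SimpleGraph.fromRel_adj _ _ _).1 hab).2 with ⟨n, rfl, rfl⟩ | ⟨n, rfl, rfl⟩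
  · exact hq.adj n
  · exact (hq.adj n).symm

theorem mem_range_of_rayTrace_adj {q : ℕ → V} {a b : V} (h : (rayTrace q).Adj a b) :
    a ∈ Set.range q := by
  rcases ((SimpleGraph.fromRel_adj _ _ _).1 h).2 with ⟨n, rfl, rfl⟩ | ⟨n, rfl, rfl⟩
  · exact ⟨_, rfl⟩
  · exact ⟨_, rfl⟩

/-- The part of a double ray between the indices `m` and `n`. -/
def segment (f : ℤ → V) (m n : ℤ) : SimpleGraph V :=
  SimpleGraph.fromRel fun a b => ∃ i, m ≤ i ∧ i < n ∧ f i = a ∧ f (i + 1) = b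

theorem segment_adj {f : ℤ → V} {m n : ℤ} {a b : V}
    (h : (segment f m n).Adj a b) : ∃ i, m ≤ i ∧ i < n ∧
      ((f i = a ∧ f (i + 1) = b) ∨ (f i = b ∧ f (i + 1) = a)) := by
  rcases ((SimpleGraph.fromRel_adj _ _ _).1 h).2 with ⟨i, h1, h2, h⟩ | ⟨i, h1, h2, h⟩
  · exact ⟨i, h1, h2, Or.inl h⟩
  · exact ⟨i, h1, h2, Or.inr h⟩

theorem segment_le {K : SimpleGraph V} {f : ℤ → V} (hf : IsDoubleRay K f) (m n : ℤ) :
    segment f m n ≤ trace f := by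
  intro a b hab
  obtain ⟨i, -, -, h⟩ := segment_adj hab
  exact (trace_adj hf.inj).2 ⟨i, h⟩

theorem segment_reachable {K : SimpleGraph V} {f : ℤ → V} (hf : IsDoubleRay K f) {m n : ℤ}
    (hmn : m ≤ n) : (segment f m n).Reachable (f m) (f n) := by
  have key : ∀ k : ℕ, m + k ≤ n → (segment f m n).Reachable (f m) (f (m + k)) := by
    intro k
    induction k with
    | zero => intro _; simp
    | succ k ih =>
      intro hk
      push_cast at hk
      refine (ih (by omega)).trans (SimpleGraph.Adj.reachable ?_)
      refine (SimpleGraph.fromRel_adj _ _ _).2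
        ⟨fun h => ?_, Or.inl ⟨m + k, by omega, by omega, rfl, ?_⟩⟩
      · have := hf.inj h
        push_cast at this
        omega
      · push_cast; rw [add_assoc]
  have := key (n - m).toNat (by omega)
  rwa [show m + ((n - m).toNat : ℤ) = n by omega] at this

/-- Infinitely many rays attached to a double ray along an increasing sequence of its vertices. -/
theorem infinitePacking_of_comb {K : SimpleGraph V} {f : ℤ → V} (hf : IsDoubleRay K f)
    {q : ℕ → ℕ → V} (hq : ∀ i, IsRay (K \ trace f) (q i))
    (hqq : ∀ i j m n, i ≠ j → q i m ≠ q j n) {k : ℕ → ℤ} (hk : StrictMono k)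
    (hkq : ∀ i, q i 0 = f (k i)) : InfinitePacking K := by
  -- Consecutive rays are paired. The segments of `f` between the two feet of a pair do not overlap,
  -- because `k` is strictly increasing.
  let F : ℕ → SimpleGraph V := fun j =>
    segment f (k (2 * j)) (k (2 * j + 1)) ⊔ (rayTrace (q (2 * j)) ⊔ rayTrace (q (2 * j + 1)))
  have hF : ∀ j, F j ≤ K := fun j =>
    sup_le ((segment_le hf _ _).trans hf.trace_le)
      (sup_le ((hq _).rayTrace_le.trans sdiff_le) ((hq _).rayTrace_le.trans sdiff_le))
  have hseg : ∀ i a b m n, (rayTrace (q i)).Adj a b → ¬ (segment f m n).Adj a b :=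
    fun i a b m n h h' => ((hq i).rayTrace_le h).2 (segment_le hf _ _ h')
  have hrr : ∀ i j a b, i ≠ j → (rayTrace (q i)).Adj a b → ¬ (rayTrace (q j)).Adj a b := by
    intro i j a b hij h h'
    obtain ⟨m, rfl⟩ := mem_range_of_rayTrace_adj h
    obtain ⟨n, hn⟩ := mem_range_of_rayTrace_adj h'
    exact hqq i j m n hij hn.symm
  have hdis : ∀ i j, i < j → Disjoint (F i) (F j) := by
    intro i j hij
    rw [disjoint_iff_adj]
    rintro a b (h | h | h) (h' | h' | h')
    · obtain ⟨s, -, hs2, hs⟩ := segment_adj h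
      obtain ⟨t, ht1, -, ht⟩ := segment_adj h'
      have h1 : k (2 * i + 1) < k (2 * j) := hk (by omega)
      rcases hs with ⟨h1, h2⟩ | ⟨h1, h2⟩ <;> rcases ht with ⟨h3, h4⟩ | ⟨h3, h4⟩
      · have := hf.inj (h1.trans h3.symm); omega
      · have := hf.inj (h1.trans h4.symm); omega
      · have := hf.inj (h1.trans h4.symm); omega
      · have := hf.inj (h1.trans h3.symm); omega
    · exact hseg _ _ _ _ _ h' h
    · exact hseg _ _ _ _ _ h' h
    · exact hseg _ _ _ _ _ h h'
    · exact hrr _ _ _ _ (by omega) h h'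
    · exact hrr _ _ _ _ (by omega) h h'
    · exact hseg _ _ _ _ _ h h'
    · exact hrr _ _ _ _ (by omega) h h'
    · exact hrr _ _ _ _ (by omega) h h'
  have hex : ∀ j, ∃ g, IsDoubleRay (F j) g := by
    intro j
    obtain ⟨g, hg, -⟩ := exists_isDoubleRay_of_rays (K := F j)
      ((isRay_rayTrace (hq (2 * j + 1))).mono (le_sup_right.trans le_sup_right))
      ((isRay_rayTrace (hq (2 * j))).mono (le_sup_left.trans le_sup_right))
      (fun m n => hqq _ _ m n (by omega)) (by
        rw [hkq, hkq]
        exact (segment_reachable hf (hk (by omega)).le).mono le_sup_left)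
    exact ⟨g, hg⟩
  choose g hg using hex
  refine ⟨g, fun i => (hg i).mono (hF i), fun i j hij => ?_⟩
  rcases lt_or_gt_of_ne hij with h | h
  · exact (hdis i j h).mono (hg i).trace_le (hg j).trace_le
  · exact ((hdis j i h).mono (hg j).trace_le (hg i).trace_le).symm

theorem SameTail.reachable {K : SimpleGraph V} {q r : ℕ → V} (hq : IsRay K q) (hr : IsRay K r)
    (h : SameTail q r) : K.Reachable (q 0) (r 0) := by
  obtain ⟨a, b, hab⟩ := h
  have := hab 0
  have h1 := hq.reachable 0 (0 + a)
  rw [this] at h1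
  exact h1.trans (hr.reachable _ _)

/-- Follow the walk only until it is about to use an edge of `f`; at that moment it is on `f`. -/
theorem reachable_range_sdiff {K : SimpleGraph V} {f : ℤ → V} (hf : IsDoubleRay K f) {x y : V}
    (w : K.Walk x y) (hy : y ∈ Set.range f) :
    ∃ z ∈ Set.range f, (K \ trace f).Reachable x z := by
  induction w with
  | nil => exact ⟨_, hy, SimpleGraph.Reachable.refl _⟩
  | @cons x x' y hxx' w ih =>
    by_cases h : (trace f).Adj x x'
    · exact ⟨x, mem_range_of_trace_adj hf.inj h, SimpleGraph.Reachable.refl _⟩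
    · obtain ⟨z, hz, hr⟩ := ih hy
      have hadj : (K \ trace f).Adj x x' := ⟨hxx', h⟩
      exact ⟨z, hz, hadj.reachable.trans hr⟩

/-- Join two of the rays to a double ray `f`. Its tails lie on those two, so every other ray has a
tail avoiding `f`. After deletion of the edges of `f`, either infinitely many of these tails share a
component, or infinitely many components each contain a ray starting on `f`; the latter rays form a
comb with spine `f`. -/
theorem HasConnectedRays.step {K : SimpleGraph V} (h : HasConnectedRays K) :
    InfinitePacking K ∨ ∃ f, IsDoubleRay K f ∧ HasConnectedRays (K \ trace f) := by
  obtain ⟨r, hr, hrr, hreach⟩ := h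
  obtain ⟨f, hf, ⟨a, b, hab⟩, ⟨a', b', hab'⟩⟩ := exists_isDoubleRay_of_rays (hr 0) (hr 1)
    (fun m n => hrr 0 1 m n (by omega)) (hreach 1 0)
  have htail : ∀ i, ∃ c, ∀ n, r (i + 2) (n + c) ∉ Set.range f := by
    intro i
    have hfin : {n | r (i + 2) n ∈ Set.range f}.Finite := by
      have : r (i + 2) '' {n | r (i + 2) n ∈ Set.range f} ⊆ f '' Set.Ioo (-(a' : ℤ)) a := by
        rintro _ ⟨n, ⟨m, hm⟩, rfl⟩
        refine ⟨m, ⟨?_, ?_⟩, hm⟩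
        · by_contra hlt
          have := hab' (-m - a').toNat
          dsimp only at this
          rw [show -(((-m - a').toNat + a' : ℕ) : ℤ) = m by omega] at this
          exact hrr (i + 2) 1 _ _ (by omega) (hm.symm.trans this)
        · by_contra hlt
          have := hab (m - a).toNat
          dsimp only at this
          rw [show (((m - a).toNat + a : ℕ) : ℤ) = m by omega] at this
          exact hrr (i + 2) 0 _ _ (by omega) (hm.symm.trans this)
      exact Set.Finite.of_finite_image (((Set.finite_Ioo _ _).image f).subset this)
        (hr _).inj.injOn
    obtain ⟨c, hc⟩ := hfin.bddAbove
    refine ⟨c + 1, fun n hn => ?_⟩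
    have := hc hn
    omega
  choose c hc using htail
  let t : ℕ → ℕ → V := fun i n => r (i + 2) (n + c i)
  have ht : ∀ i, IsRay (K \ trace f) (t i) := fun i =>
    ⟨((hr (i + 2)).tail (c i)).inj, fun n =>
      ⟨((hr (i + 2)).tail (c i)).adj n, fun h => hc i n (mem_range_of_trace_adj hf.inj h)⟩⟩
  have htt : ∀ i j m n, i ≠ j → t i m ≠ t j n := fun i j m n hij =>
    hrr _ _ _ _ (by omega)
  let g : ℕ → (K \ trace f).ConnectedComponent := fun i =>
    (K \ trace f).connectedComponentMk (t i 0)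
  by_cases hfin : (Set.range g).Finite
  · right
    refine ⟨f, hf, ?_⟩
    have : Finite (Set.range g) := hfin
    obtain ⟨C, hC⟩ := Finite.exists_infinite_fiber (Set.rangeFactorization g)
    have hC' : (Set.rangeFactorization g ⁻¹' {C}).Infinite := Set.infinite_coe_iff.1 hC
    let φ := hC'.natEmbedding
    have hφ : ∀ i, g (φ i) = C := fun i => congrArg Subtype.val (φ i).2
    refine ⟨fun i => t (φ i), fun i => ht _, fun i j m n hij => htt _ _ _ _ ?_, fun i j => ?_⟩
    · exact fun h => hij (φ.injective (Subtype.ext h))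
    · exact SimpleGraph.ConnectedComponent.exact ((hφ i).trans (hφ j).symm)
  · left
    let φ := Set.Infinite.natEmbedding _ hfin
    choose ψ hψ using fun i => (φ i).2
    have hψinj : ∀ i j, i ≠ j → ¬ (K \ trace f).Reachable (t (ψ i) 0) (t (ψ j) 0) := by
      intro i j hij h
      have : g (ψ i) = g (ψ j) := SimpleGraph.ConnectedComponent.sound h
      rw [hψ, hψ] at this
      exact hij (φ.injective (Subtype.ext this))
    have hex : ∀ i, ∃ q, IsRay (K \ trace f) q ∧ q 0 ∈ Set.range f ∧
        (K \ trace f).Reachable (q 0) (t (ψ i) 0) := by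
      intro i
      have h1 : K.Reachable (t (ψ i) 0) (f a) := by
        have := hab 0
        rw [zero_add, zero_add] at this
        dsimp only at this
        rw [this]
        exact ((hr _).reachable _ 0).trans ((hreach _ 0).trans ((hr 0).reachable _ _))
      obtain ⟨w⟩ := h1
      obtain ⟨z, hz, hzr⟩ := reachable_range_sdiff hf w ⟨_, rfl⟩
      obtain ⟨q, hq, hq0, -, hqt⟩ := exists_ray_from_set (ht (ψ i)) (hc (ψ i)) hz hzr.symm
      exact ⟨q, hq, hq0, hqt.reachable hq (ht _)⟩
    choose q hq hq0 hqt using hex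
    choose k hk using hq0
    have hqq : ∀ i j m n, i ≠ j → q i m ≠ q j n := by
      intro i j m n hij h
      apply hψinj i j hij
      have h1 := (hq i).reachable 0 m
      rw [h] at h1
      exact (hqt i).symm.trans (h1.trans (((hq j).reachable n 0).trans (hqt j)))
    have hkinj : Function.Injective k := by
      intro i j hij
      by_contra hne
      exact hqq i j 0 0 hne (by rw [← hk, ← hk, hij])
    -- The feet are distinct, so some subsequence is strictly monotone; in the decreasing case `f`
    -- is reversed.
    obtain ⟨e, he | he⟩ := exists_increasing_or_nonincreasing_subseq (· < ·) k
    · exact infinitePacking_of_comb hf (fun i => hq (e i))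
        (fun i j m n hij => hqq _ _ _ _ (e.injective.ne hij)) (k := fun i => k (e i))
        (fun i j hij => he i j hij) fun i => (hk _).symm
    · refine infinitePacking_of_comb hf.neg (q := fun i => q (e i)) (fun i => ?_)
        (fun i j m n hij => hqq _ _ _ _ (e.injective.ne hij)) (k := fun i => -k (e i))
        (fun i j hij => ?_) fun i => by simp [hk]
      · rw [trace_neg hf.inj]; exact hq _
      · have h1 := he i j hij
        have h2 : k (e i) ≠ k (e j) := hkinj.ne (e.injective.ne hij.ne)
        dsimp only
        omega

theorem HasConnectedRays.infinitePacking {G : SimpleGraph V} (h : HasConnectedRays G) :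
    InfinitePacking G := by
  by_contra hno
  have hstep : ∀ K : {K : SimpleGraph V // K ≤ G ∧ HasConnectedRays K},
      ∃ f, IsDoubleRay K.1 f ∧ HasConnectedRays (K.1 \ trace f) := by
    rintro ⟨K, hK, hKr⟩
    rcases hKr.step with h | h
    · exact (hno (h.mono hK)).elim
    · exact h
  choose f hf hfr using hstep
  let S : ℕ → {K : SimpleGraph V // K ≤ G ∧ HasConnectedRays K} := fun n =>
    Nat.rec ⟨G, le_rfl, h⟩ (fun _ K => ⟨K.1 \ trace (f K), sdiff_le.trans K.2.1, hfr K⟩) n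
  have hS : ∀ n, (S (n + 1)).1 = (S n).1 \ trace (f (S n)) := fun n => rfl
  have hanti : Antitone fun n => (S n).1 := antitone_nat_of_succ_le fun n => by
    rw [hS]; exact sdiff_le
  have hdis : ∀ i j, i < j → Disjoint (trace (f (S i))) (trace (f (S j))) := by
    intro i j hij
    have h1 : trace (f (S j)) ≤ (S i).1 \ trace (f (S i)) := by
      rw [← hS]
      exact (hf (S j)).trace_le.trans (hanti hij)
    exact disjoint_sdiff_self_right.mono_right h1
  refine hno ⟨fun n => f (S n), fun n => (hf _).mono (S n).2.1, fun i j hij => ?_⟩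
  rcases lt_or_gt_of_ne hij with h | h
  · exact hdis i j h
  · exact (hdis j i h).symm

/-! ### Exchanging the outer parts of double rays -/

/-- The edges of `H` with both ends outside `U`. -/
def outside (H : SimpleGraph V) (U : Finset V) : SimpleGraph V where
  Adj a b := H.Adj a b ∧ a ∉ U ∧ b ∉ U
  symm := ⟨fun _ _ h => ⟨h.1.symm, h.2.2, h.2.1⟩⟩
  loopless := ⟨fun _ h => h.1.ne rfl⟩

theorem outside_anti (H : SimpleGraph V) {U U' : Finset V} (h : U ⊆ U') :
    outside H U' ≤ outside H U :=
  fun _ _ hab => ⟨hab.1, fun ha => hab.2.1 (h ha), fun hb => hab.2.2 (h hb)⟩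

/-- All edges of `D` outside `H` lie in `U`. -/
def Absorbed (H D : SimpleGraph V) (U : Finset V) : Prop :=
  ∀ a b, D.Adj a b → ¬ H.Adj a b → a ∈ U

theorem Absorbed.mono {H D : SimpleGraph V} {U U' : Finset V} (h : Absorbed H D U)
    (hU : U ⊆ U') : Absorbed H D U' :=
  fun a b hab hH => hU (h a b hab hH)

/-- An edge of `D` which is not outside `U` joins two vertices of `U`, or a vertex of `U` and one
of its boundary. -/
theorem Absorbed.mem_boundary {H D : SimpleGraph V} {U : Finset V} (h : Absorbed H D U) {a b : V}
    (hab : D.Adj a b) (hB : ¬ (outside H U).Adj a b) (ha : a ∉ U) : a ∈ boundary H U ∧ b ∈ U := by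
  have hH : H.Adj a b := by
    by_contra hH
    exact ha (h a b hab hH)
  have hb : b ∈ U := by
    by_contra hb
    exact hB ⟨hH, ha, hb⟩
  exact ⟨⟨ha, b, hb, hH.symm⟩, hb⟩

/-- The parts of `D` and `X` outside `U` look alike on the boundary of `U`. -/
structure SameState (H : SimpleGraph V) (U : Finset V) (D X : SimpleGraph V) : Prop where
  degree : ∀ s ∈ boundary H U, ((D ⊓ outside H U).neighborSet s).ncard =
    ((X ⊓ outside H U).neighborSet s).ncard
  reachable : ∀ s ∈ boundary H U, ∀ t ∈ boundary H U,
    (D ⊓ outside H U).Reachable s t → (X ⊓ outside H U).Reachable s t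
  infinite : ∀ s ∈ boundary H U, {w | (D ⊓ outside H U).Reachable s w}.Infinite →
    {w | (X ⊓ outside H U).Reachable s w}.Infinite

/-- Inside `U` follow `D`, outside `U` follow `X`. -/
def glue (H : SimpleGraph V) (U : Finset V) (D X : SimpleGraph V) : SimpleGraph V :=
  (D \ outside H U) ⊔ (X ⊓ outside H U)

theorem glue_adj_of_forall_not {H D X : SimpleGraph V} {U : Finset V} {w : V}
    (hw : ∀ b, ¬ (outside H U).Adj w b) (b : V) : (glue H U D X).Adj w b ↔ D.Adj w b := by
  constructor
  · rintro (h | h)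
    · exact h.1
    · exact (hw b h.2).elim
  · exact fun h => Or.inl ⟨h, hw b⟩

/-- Degrees agree with `D` on `U` and with `X` beyond the boundary. On the boundary the outer degree
of `D` is replaced by the equal outer degree of `X`. -/
theorem isLinear_glue {H D X : SimpleGraph V} {U : Finset V} (hD : IsLinear D) (hX : IsLinear X)
    (hDU : Absorbed H D U) (hXU : Absorbed H X U) (hs : SameState H U D X) :
    IsLinear (glue H U D X) := by
  intro w
  by_cases hwU : w ∈ U
  · have : (glue H U D X).neighborSet w = D.neighborSet w := by
      ext b
      exact glue_adj_of_forall_not (fun b hb => hb.2.1 hwU) b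
    rw [this]
    exact hD w
  by_cases hwb : w ∈ boundary H U
  · have hfin := hD.finite w
    have h1 : (glue H U D X).neighborSet w =
        (D \ outside H U).neighborSet w ∪ (X ⊓ outside H U).neighborSet w := by
      ext b; rfl
    have h2 : D.neighborSet w =
        (D \ outside H U).neighborSet w ∪ (D ⊓ outside H U).neighborSet w := by
      ext b
      simp only [Set.mem_union, SimpleGraph.mem_neighborSet, SimpleGraph.sdiff_adj,
        SimpleGraph.inf_adj]
      tauto
    have hf1 : ((D \ outside H U).neighborSet w).Finite := hfin.subset fun b hb => hb.1
    have hf2 : ((D ⊓ outside H U).neighborSet w).Finite := hfin.subset fun b hb => hb.1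
    have hf3 : ((X ⊓ outside H U).neighborSet w).Finite := (hX.finite w).subset fun b hb => hb.1
    have hcard : ((glue H U D X).neighborSet w).ncard = (D.neighborSet w).ncard := by
      rw [h1, h2, Set.ncard_union_eq _ hf1 hf3, Set.ncard_union_eq _ hf1 hf2, hs.degree w hwb]
      · exact Set.disjoint_left.2 fun b hb hb' => hb.2 hb'.2
      · exact Set.disjoint_left.2 fun b hb hb' => hb.2 hb'.2
    rcases hD w with h | h
    · left
      rw [h, Set.ncard_empty] at hcard
      exact (Set.ncard_eq_zero (h1 ▸ hf1.union hf3)).1 hcard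
    · right
      rw [hcard, h]
  · have : (glue H U D X).neighborSet w = X.neighborSet w := by
      ext b
      constructor
      · rintro (h | h)
        · exact (hwb (hDU.mem_boundary h.1 h.2 hwU).1).elim
        · exact h.1
      · intro h
        refine Or.inr ⟨h, ?_⟩
        by_contra hB
        exact hwb (hXU.mem_boundary h hB hwU).1
    rw [this]
    exact hX w

theorem notMem_of_reachable {H D : SimpleGraph V} {U : Finset V} {s w : V} (hs : s ∉ U)
    (h : (D ⊓ outside H U).Reachable s w) : w ∉ U := by
  obtain ⟨p⟩ := h
  induction p with
  | nil => exact hs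
  | cons hadj _ ih => exact ih hadj.2.2.2

/-- Each excursion of a walk in `D` outside `U` that returns can be replaced by one in `X` with the
same boundary ends. So the component of `v` in `D` is covered by its component in the glued graph
and the outer parts of `D` at finitely many boundary vertices of that component. If the new
component were finite, the state would make those outer parts finite too. -/
theorem infinite_glue {H D X : SimpleGraph V} {U : Finset V} {v : V}
    (hH : ∀ v, (H.neighborSet v).Finite) (hv : v ∈ U)
    (hinf : {w | D.Reachable v w}.Infinite) (hDU : Absorbed H D U) (hs : SameState H U D X) :
    {w | (glue H U D X).Reachable v w}.Infinite := by
  set E := glue H U D X with hE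
  have hXE : X ⊓ outside H U ≤ E := le_sup_right
  have key : ∀ x y (p : D.Walk x y),
      ((x ∈ U ∧ E.Reachable v x) ∨
        ∃ s ∈ boundary H U, E.Reachable v s ∧ (D ⊓ outside H U).Reachable s x) →
      ((y ∈ U ∧ E.Reachable v y) ∨
        ∃ s ∈ boundary H U, E.Reachable v s ∧ (D ⊓ outside H U).Reachable s y) := by
    intro x y p
    induction p with
    | nil => exact id
    | @cons x z y hxz p ih =>
      intro h
      apply ih
      rcases h with ⟨hx, hvx⟩ | ⟨s, hs', hvs, hsx⟩
      · have hB : ¬ (outside H U).Adj x z := fun h => h.2.1 hx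
        have hxz' : E.Adj x z := Or.inl ⟨hxz, hB⟩
        by_cases hz : z ∈ U
        · exact Or.inl ⟨hz, hvx.trans hxz'.reachable⟩
        · exact Or.inr ⟨z, (hDU.mem_boundary hxz.symm (fun h => hB h.symm) hz).1,
            hvx.trans hxz'.reachable, SimpleGraph.Reachable.refl _⟩
      · by_cases hB : (outside H U).Adj x z
        · have hadj : (D ⊓ outside H U).Adj x z := ⟨hxz, hB⟩
          exact Or.inr ⟨s, hs', hvs, hsx.trans hadj.reachable⟩
        · obtain ⟨hxb, hz⟩ := hDU.mem_boundary hxz hB (notMem_of_reachable hs'.1 hsx)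
          have hxz' : E.Adj x z := Or.inl ⟨hxz, hB⟩
          exact Or.inl ⟨hz, (hvs.trans ((hs.reachable s hs' x hxb hsx).mono hXE)).trans
            hxz'.reachable⟩
  by_contra hfin
  rw [Set.not_infinite] at hfin
  apply hinf
  have hsub : {w | D.Reachable v w} ⊆ {w | E.Reachable v w} ∪
      ⋃ s ∈ {s | s ∈ boundary H U ∧ E.Reachable v s}, {w | (D ⊓ outside H U).Reachable s w} := by
    rintro w ⟨p⟩
    rcases key v w p (Or.inl ⟨hv, SimpleGraph.Reachable.refl _⟩) with h | ⟨s, h1, h2, h3⟩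
    · exact Or.inl h.2
    · exact Or.inr (Set.mem_biUnion (show s ∈ {s | s ∈ boundary H U ∧ E.Reachable v s} from
        ⟨h1, h2⟩) h3)
  refine (hfin.union (Set.Finite.biUnion ((finite_boundary hH U).subset fun s h => h.1) ?_)).subset
    hsub
  rintro s ⟨hsb, hvs⟩
  by_contra hsinf
  exact (hs.infinite s hsb hsinf) (hfin.subset fun w hw => hvs.trans (hw.mono hXE))

/-! ### Connecting two vertices while meeting few members of an edge-disjoint family -/

/-- The graph `G` without the edges of those `Y j` for which `j` is not in `J`. -/
def avoiding {ι : Type*} (G : SimpleGraph V) (Y : ι → SimpleGraph V) (J : Finset ι) :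
    SimpleGraph V where
  Adj a b := G.Adj a b ∧ ∀ j ∉ J, ¬ (Y j).Adj a b
  symm := ⟨fun _ _ h => ⟨h.1.symm, fun j hj hab => h.2 j hj hab.symm⟩⟩
  loopless := ⟨fun _ h => h.1.ne rfl⟩

theorem avoiding_mono {ι : Type*} (G : SimpleGraph V) (Y : ι → SimpleGraph V) {J J' : Finset ι}
    (h : J ⊆ J') : avoiding G Y J ≤ avoiding G Y J' :=
  fun _ _ hab => ⟨hab.1, fun j hj => hab.2 j fun hj' => hj (h hj')⟩

theorem le_avoiding {ι : Type*} {G : SimpleGraph V} {Y : ι → SimpleGraph V} {J : Finset ι}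
    (hYG : ∀ j, Y j ≤ G) (hY : ∀ i j, i ≠ j → Disjoint (Y i) (Y j)) {j : ι} (hj : j ∈ J) :
    Y j ≤ avoiding G Y J :=
  fun a b hab => ⟨hYG j hab, fun i hi => disjoint_iff_adj.1
    (hY j i fun h => hi (h ▸ hj)) a b hab⟩

/-- The bound does not depend on the size of the family. A walk that uses an edge of `Y j` can make
a detour along `Y j` to `S`, so it splits into pieces between vertices of `S` that need at most two
members each. Shortcutting to a path in the auxiliary graph `Q` on `S` leaves fewer than `S.card`
pieces. -/
theorem exists_reachable_avoiding {ι : Type*} {G : SimpleGraph V} {Y : ι → SimpleGraph V}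
    {S : Finset V} (hYG : ∀ j, Y j ≤ G) (hY : ∀ i j, i ≠ j → Disjoint (Y i) (Y j))
    (hYS : ∀ j a b, (Y j).Adj a b → ∃ s ∈ S, (Y j).Reachable a s) {x y : V} (hx : x ∈ S)
    (hy : y ∈ S) (hxy : G.Reachable x y) :
    ∃ J : Finset ι, J.card ≤ 2 * S.card ∧ (avoiding G Y J).Reachable x y := by
  classical
  let Q : SimpleGraph S := SimpleGraph.fromRel fun s t =>
    ∃ J : Finset ι, J.card ≤ 2 ∧ (avoiding G Y J).Reachable (s : V) t
  have hQ : ∀ (s t : S) (J : Finset ι), J.card ≤ 2 → (avoiding G Y J).Reachable (s : V) t →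
      Q.Reachable s t := by
    intro s t J hJ h
    by_cases hst : s = t
    · rw [hst]
    · exact SimpleGraph.Adj.reachable ((SimpleGraph.fromRel_adj _ _ _).2
        ⟨hst, Or.inl ⟨J, hJ, h⟩⟩)
  have key : ∀ u w (p : G.Walk u w),
      (∃ s : S, Q.Reachable ⟨x, hx⟩ s ∧
        ∃ J : Finset ι, J.card ≤ 1 ∧ (avoiding G Y J).Reachable (s : V) u) →
      ∃ s : S, Q.Reachable ⟨x, hx⟩ s ∧
        ∃ J : Finset ι, J.card ≤ 1 ∧ (avoiding G Y J).Reachable (s : V) w := by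
    intro u w p
    induction p with
    | nil => exact id
    | @cons u z w huz p ih =>
      rintro ⟨s, hxs, J, hJ, hsu⟩
      apply ih
      by_cases hj : ∃ j, (Y j).Adj u z
      · obtain ⟨j, hj⟩ := hj
        obtain ⟨t, ht, hut⟩ := hYS j u z hj
        have hle : ∀ J' : Finset ι, j ∈ J' → Y j ≤ avoiding G Y J' :=
          fun J' hj' => le_avoiding hYG hY hj'
        refine ⟨⟨t, ht⟩, hxs.trans (hQ _ _ (insert j J) ?_ ?_), {j}, by simp, ?_⟩
        · exact (Finset.card_insert_le _ _).trans (by omega)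
        · exact (hsu.mono (avoiding_mono G Y (Finset.subset_insert _ _))).trans
            (hut.mono (hle _ (Finset.mem_insert_self _ _)))
        · exact (hut.symm.trans hj.reachable).mono (hle _ (Finset.mem_singleton_self _))
      · push Not at hj
        have hadj : (avoiding G Y J).Adj u z := ⟨huz, fun j _ => hj j⟩
        exact ⟨s, hxs, J, hJ, hsu.trans hadj.reachable⟩
  obtain ⟨p⟩ := hxy
  obtain ⟨s, hxs, J, hJ, hsy⟩ := key x y p
    ⟨⟨x, hx⟩, SimpleGraph.Reachable.refl _, ∅, by simp, SimpleGraph.Reachable.refl _⟩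
  have hxy' : Q.Reachable ⟨x, hx⟩ ⟨y, hy⟩ := hxs.trans (hQ s ⟨y, hy⟩ J (by omega) hsy)
  have hlen : ∀ (s t : S) (p : Q.Walk s t), ∃ J : Finset ι, J.card ≤ 2 * p.length ∧
      (avoiding G Y J).Reachable (s : V) t := by
    intro s t p
    induction p with
    | nil => exact ⟨∅, by simp, SimpleGraph.Reachable.refl _⟩
    | @cons s u t hsu p ih =>
      obtain ⟨J, hJ, hut⟩ := ih
      obtain ⟨J', hJ', hsu'⟩ : ∃ J : Finset ι, J.card ≤ 2 ∧
          (avoiding G Y J).Reachable (s : V) u := by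
        rcases ((SimpleGraph.fromRel_adj _ _ _).1 hsu).2 with h | ⟨J, hJ, h⟩
        · exact h
        · exact ⟨J, hJ, h.symm⟩
      refine ⟨J' ∪ J, ?_, (hsu'.mono (avoiding_mono G Y Finset.subset_union_left)).trans
        (hut.mono (avoiding_mono G Y Finset.subset_union_right))⟩
      have := Finset.card_union_le J' J
      rw [SimpleGraph.Walk.length_cons]
      omega
  obtain ⟨q, hq⟩ := hxy'.exists_isPath
  obtain ⟨J, hJ, h⟩ := hlen _ _ q
  refine ⟨J, ?_, h⟩
  have := hq.length_lt
  rw [Fintype.card_coe] at this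
  omega

/-! ### Double rays with the same tails -/

/-- All but finitely many edges of `f` lie in `H`. -/
def EventuallyIn (H : SimpleGraph V) (f : ℤ → V) : Prop :=
  ∃ N : ℕ, ∀ n : ℤ, N ≤ |n| → H.Adj (f n) (f (n + 1))

/-- The maps `f` and `g` agree, up to shifts, in both directions. -/
def EqTails (g f : ℤ → V) : Prop :=
  ∃ α β c : ℤ, (∀ n, c ≤ n → g n = f (n + α)) ∧ ∀ n, n ≤ -c → g n = f (n + β)

theorem EqTails.symm {g f : ℤ → V} (h : EqTails g f) : EqTails f g := by
  obtain ⟨α, β, c, h1, h2⟩ := h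
  refine ⟨-α, -β, |c| + |α| + |β|, fun n hn => ?_, fun n hn => ?_⟩
  · have ha := le_abs_self α
    have hb := abs_nonneg β
    have hc := le_abs_self c
    rw [h1 (n + -α) (by omega)]
    congr 1; omega
  · have ha := abs_nonneg α
    have hb := neg_abs_le β
    have hc := le_abs_self c
    rw [h2 (n + -β) (by omega)]
    congr 1; omega

theorem EqTails.eventuallyIn {g f : ℤ → V} (h : EqTails g f) {H : SimpleGraph V}
    (hf : EventuallyIn H f) : EventuallyIn H g := by
  obtain ⟨α, β, c, h1, h2⟩ := h
  obtain ⟨N, hN⟩ := hf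
  refine ⟨N + c.natAbs + α.natAbs + β.natAbs + 1, fun n hn => ?_⟩
  push_cast at hn
  have hc := le_abs_self c
  have hα := neg_abs_le α
  have hα' := abs_nonneg α
  have hβ := le_abs_self β
  have hβ' := abs_nonneg β
  have hc' := abs_nonneg c
  rcases abs_cases n with ⟨h, h'⟩ | ⟨h, h'⟩
  · rw [h1 n (by omega), h1 (n + 1) (by omega), add_right_comm]
    exact hN _ (le_trans (by omega) (le_abs_self _))
  · rw [h2 n (by omega), h2 (n + 1) (by omega), add_right_comm]
    exact hN _ (le_trans (by omega) (neg_le_abs _))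

theorem EventuallyIn.exists_absorbed {H : SimpleGraph V} {f : ℤ → V} (hf : Function.Injective f)
    (h : EventuallyIn H f) : ∃ W, Absorbed H (trace f) W := by
  classical
  obtain ⟨N, hN⟩ := h
  refine ⟨(Finset.Icc (-(N + 1) : ℤ) (N + 1)).image f, fun a b hab hH => ?_⟩
  obtain ⟨n, h⟩ := (trace_adj hf).1 hab
  have hn : |n| < N := by
    by_contra hn
    rcases h with ⟨rfl, rfl⟩ | ⟨rfl, rfl⟩
    · exact hH (hN n (by omega))
    · exact hH (hN n (by omega)).symm
  rw [abs_lt] at hn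
  rcases h with ⟨rfl, rfl⟩ | ⟨rfl, rfl⟩
  · exact Finset.mem_image_of_mem f (Finset.mem_Icc.2 (by omega))
  · exact Finset.mem_image_of_mem f (Finset.mem_Icc.2 (by omega))

theorem EqTails.exists_inf_outside_le {g f : ℤ → V} (hg : Function.Injective g)
    (hf : Function.Injective f) (h : EqTails g f) (H : SimpleGraph V) :
    ∃ W, ∀ U, W ⊆ U → trace g ⊓ outside H U ≤ trace f ⊓ outside H U := by
  have hev : EventuallyIn (trace f) g :=
    h.eventuallyIn ⟨0, fun n _ => (isDoubleRay_trace hf).adj n⟩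
  obtain ⟨W, hW⟩ := hev.exists_absorbed hg
  refine ⟨W, fun U hU a b hab => ⟨?_, hab.2⟩⟩
  by_contra hfab
  exact hab.2.2.1 (hU (hW a b hab.1 hfab))

theorem EqTails.exists_inf_outside_eq {g f : ℤ → V} (hg : Function.Injective g)
    (hf : Function.Injective f) (h : EqTails g f) (H : SimpleGraph V) :
    ∃ W, ∀ U, W ⊆ U → trace g ⊓ outside H U = trace f ⊓ outside H U := by
  classical
  obtain ⟨W, hW⟩ := h.exists_inf_outside_le hg hf H
  obtain ⟨W', hW'⟩ := h.symm.exists_inf_outside_le hf hg H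
  exact ⟨W ∪ W', fun U hU => le_antisymm (hW U (Finset.union_subset_left hU))
    (hW' U (Finset.union_subset_right hU))⟩

/-- The last vertex of `f` on the boundary of `U`. -/
theorem exists_mem_boundary_infinite {H : SimpleGraph V} {f : ℤ → V}
    (hf : Function.Injective f) {U : Finset V} {N : ℕ}
    (hN : ∀ n : ℤ, N ≤ n → H.Adj (f n) (f (n + 1))) (hU : f N ∈ U) :
    ∃ m : ℕ, N ≤ m ∧ f m ∈ boundary H U ∧
      {w | (trace f ⊓ outside H U).Reachable (f m) w}.Infinite := by
  have hfin : {n : ℕ | f n ∈ U}.Finite :=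
    Set.Finite.preimage (f := fun n : ℕ => f n)
      (fun a _ b _ hab => by simpa using hf hab) U.finite_toSet
  obtain ⟨n, hn, hmax⟩ : ∃ n : ℕ, f n ∈ U ∧ ∀ k : ℕ, f k ∈ U → k ≤ n := by
    obtain ⟨n, hn, hmax⟩ := hfin.exists_maximalFor id _ ⟨N, hU⟩
    refine ⟨n, hn, fun k hk => ?_⟩
    by_contra hlt
    exact hlt (hmax hk (by simp only [id]; omega))
  have hNn : N ≤ n := hmax N hU
  have hout : ∀ k : ℕ, f ((n + 1 : ℕ) + k) ∉ U := fun k hk => by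
    have := hmax (n + 1 + k) (by push_cast at hk ⊢; exact hk)
    omega
  refine ⟨n + 1, by omega, ⟨?_, f n, hn, ?_⟩, ?_⟩
  · simpa using hout 0
  · have := hN n (by omega)
    push_cast
    exact this
  · have hray : IsRay (trace f ⊓ outside H U) fun k : ℕ => f ((n + 1 : ℕ) + k) := by
      have hr := (isDoubleRay_trace hf).right ((n + 1 : ℕ) : ℤ)
      refine ⟨hr.inj, fun k => ⟨hr.adj k, ?_, hout k, hout (k + 1)⟩⟩
      have := hN ((n + 1 : ℕ) + k) (by omega)
      rwa [add_assoc] at this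
    refine (Set.infinite_range_of_injective hray.inj).mono ?_
    rintro _ ⟨k, rfl⟩
    simpa using hray.reachable 0 k

/-- Every vertex of a part of `f` outside `U` is joined to the boundary of `U` by this part. -/
theorem exists_reachable_boundary {H : SimpleGraph V} {f : ℤ → V} (hf : Function.Injective f)
    {U : Finset V} (hU : Absorbed H (trace f) U) (h0 : f 0 ∈ U) {x b : V}
    (hx : (trace f ⊓ outside H U).Adj x b) :
    ∃ s ∈ boundary H U, (trace f ⊓ outside H U).Reachable x s := by
  have key : ∀ x y (p : (trace f).Walk x y), x ∉ U → y ∈ U →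
      ∃ s ∈ boundary H U, (trace f ⊓ outside H U).Reachable x s := by
    intro x y p
    induction p with
    | nil => exact fun h h' => (h h').elim
    | @cons x z y hxz p ih =>
      intro hx hy
      by_cases hB : (outside H U).Adj x z
      · obtain ⟨s, hs, hzs⟩ := ih hB.2.2 hy
        have hadj : (trace f ⊓ outside H U).Adj x z := ⟨hxz, hB⟩
        exact ⟨s, hs, hadj.reachable.trans hzs⟩
      · exact ⟨x, (hU.mem_boundary hxz hB hx).1, SimpleGraph.Reachable.refl _⟩
  obtain ⟨n, rfl⟩ := mem_range_of_trace_adj hf hx.1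
  obtain ⟨p⟩ := (isDoubleRay_trace hf).reachable n 0
  exact key _ _ p hx.2.2.1 h0

open Filter

/-! ### Packings in graphs with small boundaries -/

/-- An ultrafilter of finite sets with small boundaries in `H`, and a function `st` which
determines how a graph looks on these boundaries from the outside. -/
structure Levels {Q : Type*} (H : SimpleGraph V) (d : ℕ) (𝒰 : Ultrafilter (Finset V))
    (st : Finset V → SimpleGraph V → Q) : Prop where
  subset : ∀ W : Finset V, ∀ᶠ U in 𝒰, W ⊆ U
  ncard : ∀ᶠ U in 𝒰, (boundary H U).ncard ≤ d
  same : ∀ᶠ U in 𝒰, ∀ D X, IsLinear D → IsLinear X → st U D = st U X → SameState H U D X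
  congr : ∀ U D X, D ⊓ outside H U = X ⊓ outside H U → st U D = st U X

/-- `f` is a double ray of `G` with all but finitely many edges in `H` and eventual state `σ`. -/
structure IsTyped {Q : Type*} (G H : SimpleGraph V) (𝒰 : Ultrafilter (Finset V))
    (st : Finset V → SimpleGraph V → Q) (σ : Q) (f : ℤ → V) : Prop where
  isDoubleRay : IsDoubleRay G f
  eventuallyIn : EventuallyIn H f
  state : ∀ᶠ U in 𝒰, st U (trace f) = σ

/-- `D` is a graph of degrees zero and two with an infinite component at `v`, with all but
finitely many edges in `H`, and with eventual state `σ`. -/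
structure IsStrand {Q : Type*} (G H : SimpleGraph V) (𝒰 : Ultrafilter (Finset V))
    (st : Finset V → SimpleGraph V → Q) (σ : Q) (D : SimpleGraph V) (v : V) : Prop where
  le : D ≤ G
  linear : IsLinear D
  absorbed : ∃ W, Absorbed H D W
  infinite : {w | D.Reachable v w}.Infinite
  state : ∀ᶠ U in 𝒰, st U D = σ

section

variable {Q : Type*} {G H : SimpleGraph V} {d : ℕ} {𝒰 : Ultrafilter (Finset V)}
  {st : Finset V → SimpleGraph V → Q} {σ : Q}

theorem Levels.eventually_absorbed (hL : Levels H d 𝒰 st) {D : SimpleGraph V}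
    (h : ∃ W, Absorbed H D W) : ∀ᶠ U in 𝒰, Absorbed H D U := by
  obtain ⟨W, hW⟩ := h
  exact (hL.subset W).mono fun U hU => hW.mono hU

/-- In a packing with more members than `A` has edges, some member misses `A`. -/
theorem exists_disjoint_of_packing
    (hP : ∀ k : ℕ, ∃ f : Fin k → ℤ → V, (∀ i, IsTyped G H 𝒰 st σ (f i)) ∧
      ∀ i j, i ≠ j → Disjoint (trace (f i)) (trace (f j)))
    {A : SimpleGraph V} (hA : A.edgeSet.Finite) :
    ∃ f, IsTyped G H 𝒰 st σ f ∧ Disjoint (trace f) A := by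
  obtain ⟨f, hf, hd⟩ := hP (hA.toFinset.card + 1)
  by_contra! hno
  have hex : ∀ i, ∃ e ∈ hA.toFinset, e ∈ (trace (f i)).edgeSet := by
    intro i
    have := hno (f i) (hf i)
    rw [disjoint_iff_adj] at this
    push Not at this
    obtain ⟨a, b, h1, h2⟩ := this
    exact ⟨s(a, b), (Set.Finite.mem_toFinset hA).2 h2, h1⟩
  choose e he he' using hex
  obtain ⟨i, -, j, -, hij, heq⟩ := Finset.exists_ne_map_eq_of_card_lt_of_maps_to
    (s := Finset.univ) (t := hA.toFinset) (by simp) (f := e) (fun i _ => he i)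
  have h1 := he' i
  have h2 := he' j
  rw [← heq] at h2
  generalize e i = x at h1 h2
  induction x with
  | h a b => exact disjoint_iff_adj.1 (hd i j hij) a b h1 h2

/-- The two tails of a typed double ray cannot be separated by finitely many edges. -/
theorem IsTyped.exists_reachable (hL : Levels H d 𝒰 st)
    (hP : ∀ k : ℕ, ∃ f : Fin k → ℤ → V, (∀ i, IsTyped G H 𝒰 st σ (f i)) ∧
      ∀ i j, i ≠ j → Disjoint (trace (f i)) (trace (f j)))
    {A : SimpleGraph V} (hA : A.edgeSet.Finite) {f : ℤ → V} (hf : IsTyped G H 𝒰 st σ f) (N : ℕ) :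
    ∃ m n : ℕ, N ≤ m ∧ N ≤ n ∧ (G \ A).Reachable (f m) (f (-n)) := by
  classical
  obtain ⟨g, hg, hgA⟩ := exists_disjoint_of_packing hP hA
  obtain ⟨N₀, hN₀⟩ := hf.eventuallyIn
  set M : ℕ := N + N₀ + 1 with hM
  have hfinj := hf.isDoubleRay.inj
  obtain ⟨U, hUM, hUf, hUg, hUs⟩ := ((hL.subset {f M, f (-M)}).and
    (hf.state.and (hg.state.and hL.same))).exists
  have hs := hUs _ _ (isLinear_trace hfinj) (isLinear_trace hg.isDoubleRay.inj)
    (hUf.trans hUg.symm)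
  -- By equality of states the outer component of `g` at `x` is infinite as well, hence not just
  -- `{x}`. So both tails of `f` meet `g`, which avoids `A` and connects them.
  have hmem : ∀ x ∈ boundary H U, {w | (trace f ⊓ outside H U).Reachable x w}.Infinite →
      x ∈ Set.range g := by
    intro x hx hinf
    by_contra hxg
    refine (hs.infinite x hx hinf) ((Set.finite_singleton x).subset ?_)
    rintro w ⟨p⟩
    cases p with
    | nil => rfl
    | cons hadj _ => exact (hxg (mem_range_of_trace_adj hg.isDoubleRay.inj hadj.1)).elim
  obtain ⟨m, hm, hmb, hmi⟩ := exists_mem_boundary_infinite (N := M) hfinj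
    (fun n hn => hN₀ n (le_trans (by omega) (le_abs_self _))) (hUM (by simp))
  obtain ⟨n, hn, hnb, hni⟩ := exists_mem_boundary_infinite (H := H) (U := U) (N := M)
    (f := fun n => f (-n)) hf.isDoubleRay.neg.inj (fun n hn => by
      have := (hN₀ (-(n + 1)) (le_trans (by omega) (neg_le_abs _))).symm
      rwa [show -(n + 1) + 1 = -n by ring] at this) (hUM (by simp))
  rw [trace_neg hfinj] at hni
  obtain ⟨a, ha⟩ := hmem _ hmb hmi
  obtain ⟨b, hb⟩ := hmem _ hnb hni
  refine ⟨m, n, by omega, by omega, ?_⟩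
  rw [← ha, ← hb]
  refine ((isDoubleRay_trace hg.isDoubleRay.inj).reachable a b).mono ?_
  exact fun x y hxy => ⟨hg.isDoubleRay.trace_le hxy, disjoint_iff_adj.1 hgA x y hxy⟩

theorem finite_edgeSet_of_cover {A : SimpleGraph V} {U : Finset V}
    (hfin : ∀ v, (A.neighborSet v).Finite) (hU : ∀ a b, A.Adj a b → a ∈ U ∨ b ∈ U) :
    A.edgeSet.Finite := by
  refine (U.finite_toSet.biUnion fun u _ => (hfin u).image fun w => s(u, w)).subset ?_
  intro e
  induction e with
  | h a b =>
    intro hab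
    rcases hU a b hab with h | h
    · exact Set.mem_biUnion h ⟨b, hab, rfl⟩
    · exact Set.mem_biUnion h ⟨a, SimpleGraph.Adj.symm hab, Sym2.eq_swap⟩

/-- Beyond a finite set, a new double ray can be made out of the typed double rays `f j` by
touching only few of them. -/
theorem exists_new_strand (hH : ∀ v, (H.neighborSet v).Finite) (hL : Levels H d 𝒰 st)
    (hP : ∀ k : ℕ, ∃ f : Fin k → ℤ → V, (∀ i, IsTyped G H 𝒰 st σ (f i)) ∧
      ∀ i j, i ≠ j → Disjoint (trace (f i)) (trace (f j)))
    {K : ℕ} {f : Fin (K + 1) → ℤ → V} (hf : ∀ i, IsTyped G H 𝒰 st σ (f i))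
    (hff : ∀ i j, i ≠ j → Disjoint (trace (f i)) (trace (f j)))
    {U : Finset V} (hU0 : ∀ j, f j 0 ∈ U) (hUf : ∀ j, Absorbed H (trace (f j)) U)
    (hUd : (boundary H U).ncard ≤ d) {A : SimpleGraph V} (hA : A.edgeSet.Finite)
    (hAU : ∀ a b, A.Adj a b → ¬ (outside H U).Adj a b) :
    ∃ g, IsTyped G H 𝒰 st σ g ∧ ∃ J : Finset (Fin (K + 1)), J.card ≤ 2 * d + 1 ∧
      trace g ≤ avoiding (G \ A) (fun j => trace (f j) ⊓ outside H U) J := by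
  classical
  -- Only the parts outside `U` need to be saved for later exchange; the new double ray may use
  -- inner edges of any `f j`.
  set Y : Fin (K + 1) → SimpleGraph V := fun j => trace (f j) ⊓ outside H U with hY
  have hYG : ∀ j, Y j ≤ G \ A := fun j a b hab =>
    ⟨(hf j).isDoubleRay.trace_le hab.1, fun h => hAU a b h hab.2⟩
  have hYY : ∀ i j, i ≠ j → Disjoint (Y i) (Y j) := fun i j hij =>
    (hff i j hij).mono inf_le_left inf_le_left
  have hb := finite_boundary hH U
  set S := hb.toFinset with hS
  have hSmem : ∀ {s}, s ∈ S ↔ s ∈ boundary H U := Set.Finite.mem_toFinset hb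
  have hScard : S.card ≤ d := by rwa [Set.ncard_eq_toFinset_card _ hb] at hUd
  have hYS : ∀ j a b, (Y j).Adj a b → ∃ s ∈ S, (Y j).Reachable a s := by
    intro j a b hab
    obtain ⟨s, hs, h⟩ := exists_reachable_boundary (hf j).isDoubleRay.inj (hUf j) (hU0 j) hab
    exact ⟨s, hSmem.2 hs, h⟩
  -- The tails of `f 0` outside `U`.
  have hinj := (hf 0).isDoubleRay.inj
  obtain ⟨N₀, hN₀⟩ := (hf 0).eventuallyIn
  obtain ⟨N, hNN, hN⟩ : ∃ N : ℕ, N₀ < N ∧ ∀ n : ℤ, N ≤ |n| → f 0 n ∉ U := by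
    have hfin : (f 0 ⁻¹' U).Finite := Set.Finite.preimage hinj.injOn U.finite_toSet
    obtain ⟨c, hc⟩ := (hfin.image fun n : ℤ => n.natAbs).bddAbove
    refine ⟨N₀ + c + 1, by omega, fun n hn hnU => ?_⟩
    have : n.natAbs ≤ c := hc ⟨n, hnU, rfl⟩
    rw [Int.abs_eq_natAbs] at hn
    omega
  have hadj : ∀ n : ℤ, N ≤ |n| → N ≤ |n + 1| → (Y 0).Adj (f 0 n) (f 0 (n + 1)) := fun n h h' =>
    ⟨(isDoubleRay_trace hinj).adj n, hN₀ n (le_trans (by omega) h), hN n h, hN _ h'⟩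
  have hr : IsRay (Y 0) fun n : ℕ => f 0 (N + n) := by
    refine ⟨((hf 0).isDoubleRay.right N).inj, fun n => ?_⟩
    have := hadj (N + n) (le_trans (by omega) (le_abs_self _)) (le_trans (by omega) (le_abs_self _))
    rw [add_assoc] at this
    exact_mod_cast this
  have hs : IsRay (Y 0) fun n : ℕ => f 0 (-(N + n)) := by
    refine ⟨((hf 0).isDoubleRay.neg.right N).inj, fun n => ?_⟩
    have := (hadj (-(N + n + 1)) (le_trans (by omega) (neg_le_abs _))
      (le_trans (by omega) (neg_le_abs _))).symm
    rw [show -((N : ℤ) + n + 1) + 1 = -(N + n) by ring, add_assoc] at this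
    exact_mod_cast this
  have hrs : ∀ m n : ℕ, f 0 (N + m) ≠ f 0 (-(N + n)) := fun m n h => by
    have := hinj h
    omega
  -- Connect the tails.
  obtain ⟨m, n, hm, hn, hmn⟩ := (hf 0).exists_reachable hL hP hA N
  have hm' : (Y 0).Reachable (f 0 (N + (0 : ℕ))) (f 0 m) := by
    have := hr.reachable 0 (m - N)
    rwa [show (N : ℤ) + (m - N : ℕ) = m by omega] at this
  have hn' : (Y 0).Reachable (f 0 (-(N + (0 : ℕ)))) (f 0 (-n)) := by
    have := hs.reachable 0 (n - N)
    rwa [show -((N : ℤ) + (n - N : ℕ)) = -n by omega] at this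
  obtain ⟨x, hx, hrx⟩ := hYS 0 _ _ (hr.adj 0)
  obtain ⟨y, hy, hsy⟩ := hYS 0 _ _ (hs.adj 0)
  have hxy : (G \ A).Reachable x y :=
    ((hrx.symm.trans hm').mono (hYG 0)).trans (hmn.trans ((hn'.symm.trans hsy).mono (hYG 0)))
  obtain ⟨J, hJ, hJxy⟩ := exists_reachable_avoiding hYG hYY hYS hx hy hxy
  set Γ := avoiding (G \ A) Y (insert 0 J) with hΓ
  have hYΓ : Y 0 ≤ Γ := le_avoiding hYG hYY (Finset.mem_insert_self _ _)
  have hconn : Γ.Reachable (f 0 (-(N + (0 : ℕ)))) (f 0 (N + (0 : ℕ))) :=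
    (hsy.mono hYΓ).trans
      ((hJxy.symm.mono (avoiding_mono _ Y (Finset.subset_insert _ _))).trans (hrx.symm.mono hYΓ))
  obtain ⟨g, hg, ⟨a, b, hab⟩, ⟨a', b', hab'⟩⟩ :=
    exists_isDoubleRay_of_rays (hr.mono hYΓ) (hs.mono hYΓ) hrs hconn
  -- Sharing both tails with `f 0`, the new double ray agrees with it outside large sets and
  -- inherits its eventual state.
  have htails : EqTails g (f 0) := by
    refine ⟨N + b - a, a' - b' - N, a + a', fun n hn => ?_, fun n hn => ?_⟩
    · have := hab (n - a).toNat
      dsimp only at this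
      rw [show (((n - a).toNat + a : ℕ) : ℤ) = n by omega] at this
      rw [this]
      congr 1
      omega
    · have := hab' (-n - a').toNat
      dsimp only at this
      rw [show -(((-n - a').toNat + a' : ℕ) : ℤ) = n by omega] at this
      rw [this]
      congr 1
      omega
  have hΓG : Γ ≤ G := fun u v huv => huv.1.1
  refine ⟨g, ⟨hg.mono hΓG, htails.eventuallyIn (hf 0).eventuallyIn, ?_⟩, insert 0 J, ?_,
    hg.trace_le⟩
  · obtain ⟨W, hW⟩ := htails.exists_inf_outside_eq hg.inj hinj H
    filter_upwards [hL.subset W, (hf 0).state] with U hWU hst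
    rw [← hst]
    exact hL.congr U _ _ (hW U hWU)
  · have := Finset.card_insert_le 0 J
    omega

theorem IsTyped.isStrand {g : ℤ → V} (hg : IsTyped G H 𝒰 st σ g) :
    IsStrand G H 𝒰 st σ (trace g) (g 0) := by
  refine ⟨hg.isDoubleRay.trace_le, isLinear_trace hg.isDoubleRay.inj,
    hg.eventuallyIn.exists_absorbed hg.isDoubleRay.inj, ?_, hg.state⟩
  refine (Set.infinite_range_of_injective hg.isDoubleRay.inj).mono ?_
  rintro _ ⟨n, rfl⟩
  exact (isDoubleRay_trace hg.isDoubleRay.inj).reachable 0 n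

/-- Exchanging the part of a strand outside a large finite set. -/
theorem IsStrand.glue (hH : ∀ v, (H.neighborSet v).Finite) (hL : Levels H d 𝒰 st)
    {D : SimpleGraph V} {v : V} (hD : IsStrand G H 𝒰 st σ D v) {g : ℤ → V}
    (hg : IsTyped G H 𝒰 st σ g) {U : Finset V} (hv : v ∈ U) (hDU : Absorbed H D U)
    (hgU : Absorbed H (trace g) U) (hs : SameState H U D (trace g)) :
    IsStrand G H 𝒰 st σ (glue H U D (trace g)) v := by
  refine ⟨?_, isLinear_glue hD.linear (isLinear_trace hg.isDoubleRay.inj) hDU hgU hs, ⟨U, ?_⟩,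
    infinite_glue hH hv hD.infinite hDU hs, ?_⟩
  · exact sup_le (sdiff_le.trans hD.le) (inf_le_left.trans hg.isDoubleRay.trace_le)
  · rintro a b (hab | hab) hH
    · exact hDU a b hab.1 hH
    · exact (hH hab.2.1).elim
  · filter_upwards [hL.subset U, hg.state] with U' hU' hst
    rw [← hst]
    apply hL.congr
    ext a b
    constructor
    · rintro ⟨h | h, hB⟩
      · exact (h.2 (outside_anti H hU' hB)).elim
      · exact ⟨h.1, hB⟩
    · rintro ⟨h, hB⟩
      exact ⟨Or.inr ⟨h, outside_anti H hU' hB⟩, hB⟩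

/-- Fix a large `U`, find a new double ray avoiding the finitely many inner edges of the strands,
and replace the outer part of each strand by that of its own `f j` which the new double ray leaves
untouched outside `U`. Inside `W` and off the non-isolated vertices of `H` nothing changes. -/
theorem exists_extension (hH : ∀ v, (H.neighborSet v).Finite) (hL : Levels H d 𝒰 st)
    (hP : ∀ k : ℕ, ∃ f : Fin k → ℤ → V, (∀ i, IsTyped G H 𝒰 st σ (f i)) ∧
      ∀ i j, i ≠ j → Disjoint (trace (f i)) (trace (f j)))
    (k : ℕ) {D : ℕ → SimpleGraph V} {v : ℕ → V}
    (hD : ∀ l < k, IsStrand G H 𝒰 st σ (D l) (v l))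
    (hDD : ∀ l < k, ∀ l' < k, l ≠ l' → Disjoint (D l) (D l')) (W : Finset V) :
    ∃ (D' : ℕ → SimpleGraph V) (v' : ℕ → V),
      (∀ l < k + 1, IsStrand G H 𝒰 st σ (D' l) (v' l)) ∧
      (∀ l < k + 1, ∀ l' < k + 1, l ≠ l' → Disjoint (D' l) (D' l')) ∧
      ∀ l < k, v' l = v l ∧
        ∀ w, (w ∈ W ∨ ∀ b, ¬ H.Adj w b) → ∀ b, (D' l).Adj w b ↔ (D l).Adj w b := by
  classical
  -- The new double ray spoils at most `2 * d + 1` of these, which leaves one for each of the `k`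
  -- strands.
  obtain ⟨f, hf, hff⟩ := hP (2 * d + k + 1)
  have hev : ∀ᶠ U in 𝒰, ∀ l ∈ Finset.range k, v l ∈ U ∧ Absorbed H (D l) U ∧ st U (D l) = σ := by
    rw [Filter.eventually_all_finset]
    intro l hl
    have hl' := hD l (Finset.mem_range.1 hl)
    refine ((hL.subset {v l}).mono fun U hU => ?_).and
      ((hL.eventually_absorbed hl'.absorbed).and hl'.state)
    exact hU (Finset.mem_singleton_self _)
  have hev' : ∀ᶠ U in 𝒰, ∀ j, f j 0 ∈ U ∧ Absorbed H (trace (f j)) U ∧ st U (trace (f j)) = σ := by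
    rw [Filter.eventually_all]
    intro j
    refine ((hL.subset {f j 0}).mono fun U hU => ?_).and ((hL.eventually_absorbed
      ((hf j).eventuallyIn.exists_absorbed (hf j).isDoubleRay.inj)).and (hf j).state)
    exact hU (Finset.mem_singleton_self _)
  obtain ⟨U, hWU, hUD, hUf, hUd, hUs⟩ := ((hL.subset W).and (hev.and (hev'.and
    (hL.ncard.and hL.same)))).exists
  let A : SimpleGraph V := ⨆ l ∈ Finset.range k, D l \ outside H U
  have hAadj : ∀ a b, A.Adj a b ↔ ∃ l < k, (D l).Adj a b ∧ ¬ (outside H U).Adj a b := by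
    intro a b
    simp [A, SimpleGraph.iSup_adj, and_left_comm]
  have hA : A.edgeSet.Finite := by
    refine finite_edgeSet_of_cover (U := U) (fun w => ?_) fun a b hab => ?_
    · refine ((Set.finite_Iio k).biUnion fun l hl => (hD l hl).linear.finite w).subset ?_
      intro b hb
      obtain ⟨l, hl, hlb, -⟩ := (hAadj w b).1 hb
      exact Set.mem_biUnion (show l ∈ Set.Iio k from hl) hlb
    · obtain ⟨l, hl, hlb, hB⟩ := (hAadj a b).1 hab
      by_cases ha : a ∈ U
      · exact Or.inl ha
      · exact Or.inr ((hUD l (Finset.mem_range.2 hl)).2.1.mem_boundary hlb hB ha).2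
  obtain ⟨g, hg, J, hJ, hgJ⟩ := exists_new_strand hH hL hP hf hff (fun j => (hUf j).1)
    (fun j => (hUf j).2.1) hUd hA fun a b hab => ((hAadj a b).1 hab).elim fun _ h => h.2.2
  have hcard : k ≤ (Jᶜ).card := by
    rw [Finset.card_compl, Fintype.card_fin]
    omega
  let e : ℕ → Fin (2 * d + k + 1) := fun l =>
    if h : l < k then (Jᶜ).orderEmbOfCardLe hcard ⟨l, h⟩ else 0
  have heJ : ∀ l < k, e l ∉ J := fun l hl => by
    simp only [e, dif_pos hl]
    exact Finset.mem_compl.1 (Finset.orderEmbOfCardLe_mem _ _ _)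
  have heinj : ∀ l < k, ∀ l' < k, l ≠ l' → e l ≠ e l' := fun l hl l' hl' hne h => by
    simp only [e, dif_pos hl, dif_pos hl'] at h
    simpa [hne] using ((Jᶜ).orderEmbOfCardLe hcard).injective h
  let D' : ℕ → SimpleGraph V := fun l =>
    if l < k then glue H U (D l) (trace (f (e l))) else trace g
  let v' : ℕ → V := fun l => if l < k then v l else g 0
  have hD' : ∀ l < k, D' l = glue H U (D l) (trace (f (e l))) := fun l hl => if_pos hl
  have hD'k : D' k = trace g := if_neg (lt_irrefl k)
  have hnew : ∀ l < k, Disjoint (D' l) (trace g) := by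
    intro l hl
    rw [hD' l hl, disjoint_iff_adj]
    rintro a b (h | h) h'
    · exact (hgJ h').1.2 ((hAadj a b).2 ⟨l, hl, h⟩)
    · exact (hgJ h').2 (e l) (heJ l hl) h
  refine ⟨D', v', fun l hl => ?_, fun l hl l' hl' hne => ?_, fun l hl => ⟨if_pos hl, ?_⟩⟩
  · rcases (Nat.lt_succ_iff_lt_or_eq.1 hl) with hl | rfl
    · obtain ⟨h1, h2, h3⟩ := hUD l (Finset.mem_range.2 hl)
      rw [hD' l hl, show v' l = v l from if_pos hl]
      exact (hD l hl).glue hH hL (hf _) h1 h2 (hUf _).2.1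
        (hUs _ _ (hD l hl).linear (isLinear_trace (hf _).isDoubleRay.inj)
          (h3.trans (hUf _).2.2.symm))
    · rw [hD'k, show v' l = g 0 from if_neg (lt_irrefl l)]
      exact hg.isStrand
  · rcases (Nat.lt_succ_iff_lt_or_eq.1 hl) with hl | rfl <;>
      rcases (Nat.lt_succ_iff_lt_or_eq.1 hl') with hl' | rfl
    · rw [hD' l hl, hD' l' hl', disjoint_iff_adj]
      rintro a b (h | h) (h' | h')
      · exact disjoint_iff_adj.1 (hDD l hl l' hl' hne) a b h.1 h'.1
      · exact h.2 h'.2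
      · exact h'.2 h.2
      · exact disjoint_iff_adj.1 (hff _ _ (heinj l hl l' hl' hne)) a b h.1 h'.1
    · rw [hD'k]; exact hnew l hl
    · rw [hD'k]; exact (hnew l' hl').symm
    · exact (hne rfl).elim
  · intro w hw b
    rw [hD' l hl]
    refine glue_adj_of_forall_not (fun b hb => ?_) b
    rcases hw with hw | hw
    · exact hb.2.1 (hWU hw)
    · exact hw b hb.1

/-- Stage `k` freezes the strands on `W k`. Exchanges alter only edges of `H`, and the sets `W n`
cover all ends of such edges, so at each vertex every strand is eventually constant. -/
theorem infinitePacking_of_levels (hH : ∀ v, (H.neighborSet v).Finite) (hL : Levels H d 𝒰 st)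
    (hP : ∀ k : ℕ, ∃ f : Fin k → ℤ → V, (∀ i, IsTyped G H 𝒰 st σ (f i)) ∧
      ∀ i j, i ≠ j → Disjoint (trace (f i)) (trace (f j)))
    {W : ℕ → Finset V} (hWmono : Monotone W) (hW : ∀ v b, H.Adj v b → ∃ n, v ∈ W n) :
    InfinitePacking G := by
  let P : ℕ → (ℕ → SimpleGraph V) × (ℕ → V) → Prop := fun k p =>
    (∀ l < k, IsStrand G H 𝒰 st σ (p.1 l) (p.2 l)) ∧
      ∀ l < k, ∀ l' < k, l ≠ l' → Disjoint (p.1 l) (p.1 l')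
  have hstep : ∀ k (p : {p // P k p}), ∃ q : {p // P (k + 1) p}, ∀ l < k, q.1.2 l = p.1.2 l ∧
      ∀ w, (w ∈ W k ∨ ∀ b, ¬ H.Adj w b) → ∀ b, (q.1.1 l).Adj w b ↔ (p.1.1 l).Adj w b := by
    rintro k ⟨⟨D, v⟩, hD, hDD⟩
    obtain ⟨D', v', h1, h2, h3⟩ := exists_extension hH hL hP k hD hDD (W k)
    exact ⟨⟨⟨D', v'⟩, h1, h2⟩, h3⟩
  choose next hnext using hstep
  let v₀ : V := (hP 1).choose 0 0
  let S : ∀ k, {p // P k p} := fun k =>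
    Nat.rec ⟨⟨fun _ => ⊥, fun _ => v₀⟩, by simp [P]⟩ (fun k p => next k p) k
  have hS : ∀ k, ∀ l < k, (S (k + 1)).1.2 l = (S k).1.2 l ∧
      ∀ w, (w ∈ W k ∨ ∀ b, ¬ H.Adj w b) →
        ∀ b, ((S (k + 1)).1.1 l).Adj w b ↔ ((S k).1.1 l).Adj w b := fun k => hnext k (S k)
  have hv : ∀ l k, l < k → (S k).1.2 l = (S (l + 1)).1.2 l := by
    intro l k hlk
    induction k, hlk using Nat.le_induction with
    | base => rfl
    | succ k hk ih => rw [(hS k l hk).1, ih]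
  let E : ℕ → SimpleGraph V := fun l =>
    { Adj := fun a b => ∀ᶠ k in atTop, ((S k).1.1 l).Adj a b
      symm := ⟨fun a b h => h.mono fun k hk => hk.symm⟩
      loopless := ⟨fun a h => by
        obtain ⟨k, hk⟩ := h.exists
        exact hk.ne rfl⟩ }
  have hstab : ∀ l w, ∀ᶠ k in atTop, ∀ b, (E l).Adj w b ↔ ((S k).1.1 l).Adj w b := by
    intro l w
    obtain ⟨n, hn⟩ : ∃ n, w ∈ W n ∨ ∀ b, ¬ H.Adj w b := by
      by_cases h : ∃ b, H.Adj w b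
      · obtain ⟨b, hb⟩ := h
        obtain ⟨n, hn⟩ := hW w b hb
        exact ⟨n, Or.inl hn⟩
      · push Not at h
        exact ⟨0, Or.inr h⟩
    -- Strand `l` exists from stage `l + 1` on, and `w` is frozen from stage `n` on.
    set k₀ := max n (l + 1) with hk₀
    have hconst : ∀ k, k₀ ≤ k → ∀ b, ((S k).1.1 l).Adj w b ↔ ((S k₀).1.1 l).Adj w b := by
      intro k hk b
      induction k, hk using Nat.le_induction with
      | base => rfl
      | succ k hk ih =>
        rw [(hS k l (by omega)).2 w (hn.imp_left fun h => hWmono (by omega) h) b, ih]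
    filter_upwards [eventually_ge_atTop k₀] with k hk b
    rw [hconst k hk b]
    constructor
    · intro h
      obtain ⟨k', hk', h'⟩ := (h.and (eventually_ge_atTop k₀)).exists
      exact (hconst k' h' b).1 hk'
    · intro h
      exact (eventually_ge_atTop k₀).mono fun k' hk' => (hconst k' hk' b).2 h
  have hlin : ∀ l, IsLinear (E l) := by
    intro l w
    obtain ⟨k, hk, hlk⟩ := ((hstab l w).and (eventually_gt_atTop l)).exists
    have : (E l).neighborSet w = ((S k).1.1 l).neighborSet w := Set.ext hk
    rw [this]
    exact ((S k).2.1 l hlk).linear w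
  -- A finite component of the limit would be stable on all its vertices at some stage, and would
  -- contain the infinite component of the strand at that stage.
  have hinf : ∀ l, {w | (E l).Reachable ((S (l + 1)).1.2 l) w}.Infinite := by
    intro l hfin
    have hall : ∀ᶠ k in atTop, ∀ w ∈ {w | (E l).Reachable ((S (l + 1)).1.2 l) w},
        ∀ b, (E l).Adj w b ↔ ((S k).1.1 l).Adj w b :=
      (Filter.eventually_all_finite hfin).2 fun w _ => hstab l w
    obtain ⟨k, hk, hlk⟩ := (hall.and (eventually_gt_atTop l)).exists
    have hk' := ((S k).2.1 l hlk).infinite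
    rw [hv l k hlk] at hk'
    refine hk' (hfin.subset ?_)
    rintro w ⟨p⟩
    have key : ∀ x y (p : ((S k).1.1 l).Walk x y), (E l).Reachable ((S (l + 1)).1.2 l) x →
        (E l).Reachable ((S (l + 1)).1.2 l) y := by
      intro x y p
      induction p with
      | nil => exact id
      | cons hadj _ ih =>
        intro hx
        exact ih (hx.trans ((hk _ hx _).2 hadj).reachable)
    exact key _ _ p (SimpleGraph.Reachable.refl _)
  have hEG : ∀ l, E l ≤ G := by
    intro l a b hab
    obtain ⟨k, hk, hlk⟩ := (hab.and (eventually_gt_atTop l)).exists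
    exact ((S k).2.1 l hlk).le hk
  choose F hF using fun l => (hlin l).exists_isDoubleRay (hinf l)
  refine ⟨F, fun l => (hF l).mono (hEG l), fun l l' hne => ?_⟩
  refine Disjoint.mono (hF l).trace_le (hF l').trace_le (disjoint_iff_adj.2 fun a b h h' => ?_)
  obtain ⟨k, ⟨hk, hk'⟩, hlk, hlk'⟩ := ((h.and h').and
    ((eventually_gt_atTop l).and (eventually_gt_atTop l'))).exists
  exact disjoint_iff_adj.1 ((S k).2.2 l hlk l' hlk' hne) a b hk hk'

end

/-! ### Finitely many boundary states and the choice of a common one -/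

/-- How the part of a graph outside a finite set can look on at most `d` boundary vertices. -/
abbrev BoundaryState (d : ℕ) : Type :=
  (Fin d → Fin 3 → Prop) × (Fin d → Fin d → Prop) × (Fin d → Prop)

/-- Degrees, connections and infinite components of `D` outside `U`, at the vertices `c i`. -/
def boundaryState (H : SimpleGraph V) {d : ℕ} (c : Fin d → V) (U : Finset V)
    (D : SimpleGraph V) : BoundaryState d :=
  (fun i t => ((D ⊓ outside H U).neighborSet (c i)).ncard = t,
    fun i j => (D ⊓ outside H U).Reachable (c i) (c j),
    fun i => {w | (D ⊓ outside H U).Reachable (c i) w}.Infinite)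

theorem sameState_of_boundaryState_eq {H : SimpleGraph V} {d : ℕ} {c : Fin d → V} {U : Finset V}
    (hc : boundary H U ⊆ Set.range c) {D X : SimpleGraph V} (hD : IsLinear D)
    (h : boundaryState H c U D = boundaryState H c U X) : SameState H U D X := by
  obtain ⟨h1, h2, h3⟩ : _ ∧ _ ∧ _ := by simpa only [boundaryState, Prod.mk.injEq] using h
  refine ⟨fun s hs => ?_, fun s hs t ht hst => ?_, fun s hs hinf => ?_⟩
  · obtain ⟨i, rfl⟩ := hc hs
    have hle : ((D ⊓ outside H U).neighborSet (c i)).ncard ≤ 2 :=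
      (Set.ncard_le_ncard (fun b hb => hb.1) (hD.finite _)).trans (hD.ncard_le _)
    have := congrFun (congrFun h1 i) ⟨((D ⊓ outside H U).neighborSet (c i)).ncard, by omega⟩
    exact (this.mp rfl).symm
  · obtain ⟨i, rfl⟩ := hc hs
    obtain ⟨j, rfl⟩ := hc ht
    exact (congrFun (congrFun h2 i) j).mp hst
  · obtain ⟨i, rfl⟩ := hc hs
    exact (congrFun h3 i).mp hinf

theorem exists_subset_range_of_ncard_le [Nonempty V] {d : ℕ} {s : Set V} (hs : s.Finite)
    (h : s.ncard ≤ d) : ∃ c : Fin d → V, s ⊆ Set.range c := by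
  have : Fintype s := hs.fintype
  have hcard : Fintype.card s ≤ Fintype.card (Fin d) := by
    rwa [Fintype.card_fin, ← Nat.card_eq_fintype_card]
  obtain ⟨e⟩ := Function.Embedding.nonempty_of_card_le hcard
  refine ⟨Function.extend e Subtype.val fun _ => Classical.arbitrary V, fun x hx => ?_⟩
  exact ⟨e ⟨x, hx⟩, e.injective.extend_apply _ _ _⟩

theorem infinitePacking_of_boundary {G H : SimpleGraph V} (hH : ∀ v, (H.neighborSet v).Finite)
    {d : ℕ} (hd : ∀ W : Finset V, ∃ U, W ⊆ U ∧ (boundary H U).ncard ≤ d)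
    (hP : ∀ k : ℕ, ∃ f : Fin k → ℤ → V, (∀ i, IsDoubleRay G (f i)) ∧
      (∀ i j, i ≠ j → Disjoint (trace (f i)) (trace (f j))) ∧ ∀ i, EventuallyIn H (f i))
    {W : ℕ → Finset V} (hWmono : Monotone W) (hW : ∀ v b, H.Adj v b → ∃ n, v ∈ W n) :
    InfinitePacking G := by
  classical
  have : Nonempty V := ⟨(hP 1).choose 0 0⟩
  have hF : NeBot ((atTop : Filter (Finset V)) ⊓ 𝓟 {U | (boundary H U).ncard ≤ d}) :=
    frequently_mem_iff_neBot.1 (frequently_atTop.2 fun W => hd W)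
  -- As there are finitely many states, an ultrafilter decides for every graph a single state that
  -- holds eventually.
  let 𝒰 := Ultrafilter.of ((atTop : Filter (Finset V)) ⊓ 𝓟 {U | (boundary H U).ncard ≤ d})
  have hle := Ultrafilter.of_le ((atTop : Filter (Finset V)) ⊓ 𝓟 {U | (boundary H U).ncard ≤ d})
  have hcov : ∀ U : Finset V, ∃ c : Fin d → V, (boundary H U).ncard ≤ d →
      boundary H U ⊆ Set.range c := by
    intro U
    by_cases hU : (boundary H U).ncard ≤ d
    · obtain ⟨c, hc⟩ := exists_subset_range_of_ncard_le (finite_boundary hH U) hU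
      exact ⟨c, fun _ => hc⟩
    · exact ⟨fun _ => Classical.arbitrary V, fun h => (hU h).elim⟩
  choose c hc using hcov
  let st : Finset V → SimpleGraph V → BoundaryState d := fun U D => boundaryState H (c U) U D
  have hncard : ∀ᶠ U in 𝒰, (boundary H U).ncard ≤ d :=
    hle (mem_inf_of_right (mem_principal_self _))
  have hL : Levels H d 𝒰 st :=
    { subset := fun W => hle (mem_inf_of_left (eventually_ge_atTop W))
      ncard := hncard
      same := hncard.mono fun U hU D X hD _ h => sameState_of_boundaryState_eq (hc U hU) hD h
      congr := fun U D X h => by simp only [st, boundaryState, h] }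
  have hst : ∀ D, ∃ σ, ∀ᶠ U in 𝒰, st U D = σ := by
    intro D
    obtain ⟨σ, hσ⟩ := (𝒰.map fun U => st U D).eq_pure_of_finite
    refine ⟨σ, ?_⟩
    have : {σ} ∈ 𝒰.map fun U => st U D := by rw [hσ]; exact Ultrafilter.mem_pure.2 rfl
    exact this
  choose τ hτ using hst
  obtain ⟨σ, hσ⟩ : ∃ σ, ∀ k : ℕ, ∃ f : Fin k → ℤ → V, (∀ i, IsTyped G H 𝒰 st σ (f i)) ∧
      ∀ i j, i ≠ j → Disjoint (trace (f i)) (trace (f j)) := by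
    by_contra! hno
    choose k hk using hno
    have : Fintype (BoundaryState d) := Fintype.ofFinite _
    -- If every state `σ` failed for some size `k σ`, a packing with one member more than the sum of
    -- these sizes would be too large.
    obtain ⟨f, hf, hff, hfH⟩ := hP (∑ σ, k σ + 1)
    have hfib : ∀ σ, (Finset.univ.filter fun i => τ (trace (f i)) = σ).card ≤ k σ := by
      intro σ
      by_contra hlt
      set A := Finset.univ.filter fun i => τ (trace (f i)) = σ with hA
      have hkA : k σ ≤ A.card := by omega
      let e := A.orderEmbOfCardLe hkA
      have he : ∀ i, τ (trace (f (e i))) = σ := fun i => by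
        have h : e i ∈ A := Finset.orderEmbOfCardLe_mem A hkA i
        simpa [hA] using h
      obtain ⟨i, j, hij, h⟩ := hk σ (fun i => f (e i)) fun i =>
        ⟨hf _, hfH _, (hτ _).mono fun U hU => hU.trans (he i)⟩
      exact h (hff _ _ (e.injective.ne hij))
    have h1 := Finset.card_eq_sum_card_fiberwise (f := fun i => τ (trace (f i)))
      (s := Finset.univ) (t := Finset.univ) (fun i _ => Finset.mem_univ _)
    rw [Finset.card_univ, Fintype.card_fin] at h1
    have h2 := Finset.sum_le_sum fun σ (_ : σ ∈ Finset.univ) => hfib σ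
    omega
  exact infinitePacking_of_levels hH hL hσ hWmono hW

/-! ### A locally finite graph containing the tails of countably many double rays -/

theorem finite_encode_le {α : Type*} [Encodable α] (n : ℕ) :
    {a : α | Encodable.encode a ≤ n}.Finite :=
  Set.Finite.preimage Encodable.encode_injective.injOn (Set.finite_Iic n)

/-- Cut `X j` off so late that its tails avoid every `X i m` for which the pair `(i, m)` has code at
most that of `j`. Then `X i m` lies only on tails of the finitely many `X j` with smaller code, each
contributing at most two edges. -/
theorem exists_locallyFinite {J : Type*} [Encodable J] {X : J → ℤ → V}
    (hX : ∀ j, Function.Injective (X j)) :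
    ∃ H : SimpleGraph V, (∀ v, (H.neighborSet v).Finite) ∧ (∀ j, EventuallyIn H (X j)) ∧
      ∀ a b, H.Adj a b → ∃ j, (trace (X j)).Adj a b := by
  have hN : ∀ j, ∃ N : ℕ, ∀ p : J × ℤ, Encodable.encode p ≤ Encodable.encode j →
      ∀ n : ℤ, N ≤ |n| → X j n ≠ X p.1 p.2 := by
    intro j
    have hfin : {n | ∃ p : J × ℤ, Encodable.encode p ≤ Encodable.encode j ∧
        X j n = X p.1 p.2}.Finite := by
      have h1 := (finite_encode_le (α := J × ℤ) (Encodable.encode j)).image fun p => X p.1 p.2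
      refine (Set.Finite.preimage (hX j).injOn h1).subset ?_
      rintro n ⟨p, hp, hn⟩
      exact ⟨p, hp, hn.symm⟩
    obtain ⟨c, hc⟩ := (hfin.image fun n : ℤ => n.natAbs).bddAbove
    refine ⟨c + 1, fun p hp n hn h => ?_⟩
    have : n.natAbs ≤ c := hc ⟨n, ⟨p, hp, h⟩, rfl⟩
    rw [Int.abs_eq_natAbs] at hn
    omega
  choose N hN using hN
  let H : SimpleGraph V := SimpleGraph.fromRel fun a b =>
    ∃ j, ∃ n : ℤ, N j ≤ |n| ∧ N j ≤ |n + 1| ∧ X j n = a ∧ X j (n + 1) = b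
  have hadj : ∀ a b, H.Adj a b →
      ∃ j, (trace (X j)).Adj a b ∧ ∃ n : ℤ, N j ≤ |n| ∧ X j n = a := by
    intro a b hab
    rcases ((SimpleGraph.fromRel_adj _ _ _).1 hab).2 with ⟨j, n, h1, h2, h3, h4⟩ |
      ⟨j, n, h1, h2, h3, h4⟩
    · exact ⟨j, (trace_adj (hX j)).2 ⟨n, Or.inl ⟨h3, h4⟩⟩, n, h1, h3⟩
    · exact ⟨j, (trace_adj (hX j)).2 ⟨n, Or.inr ⟨h3, h4⟩⟩, n + 1, h2, h4⟩
  refine ⟨H, fun v => ?_, fun j => ⟨N j + 1, fun n hn => ?_⟩, fun a b hab => ?_⟩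
  · rcases (H.neighborSet v).eq_empty_or_nonempty with h | ⟨b, hb⟩
    · simp [h]
    obtain ⟨i, -, m, -, rfl⟩ := hadj v b hb
    refine ((finite_encode_le (α := J) (Encodable.encode (i, m))).biUnion fun j _ =>
      (isLinear_trace (hX j)).finite (X i m)).subset ?_
    intro b hb
    obtain ⟨j, hj, n, hn, hjn⟩ := hadj _ b hb
    refine Set.mem_biUnion (show Encodable.encode j ≤ Encodable.encode (i, m) from ?_) hj
    by_contra hlt
    exact hN j (i, m) (by omega) n hn hjn
  · push_cast at hn
    refine (SimpleGraph.fromRel_adj _ _ _).2 ⟨fun h => ?_, Or.inl ⟨j, n, by omega, ?_, rfl, rfl⟩⟩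
    · have := hX j h
      omega
    · rcases abs_cases n with ⟨h, h'⟩ | ⟨h, h'⟩ <;>
        rcases abs_cases (n + 1) with ⟨h1, h2⟩ | ⟨h1, h2⟩ <;> omega
  · obtain ⟨j, hj, -⟩ := hadj a b hab
    exact ⟨j, hj⟩

/-! ### The final case distinction -/

/-- Infinitely many disjoint rays, each of them meeting a double ray. -/
theorem infinitePacking_of_disjoint_rays {G : SimpleGraph V} {r : ℕ → ℕ → V}
    (hr : ∀ i, IsRay G (r i)) (hrr : ∀ i j m n, i ≠ j → r i m ≠ r j n)
    (hD : ∀ i, ∃ f, IsDoubleRay G f ∧ r i 0 ∈ Set.range f) : InfinitePacking G := by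
  let g : ℕ → G.ConnectedComponent := fun i => G.connectedComponentMk (r i 0)
  by_cases hfin : (Set.range g).Finite
  · have : Finite (Set.range g) := hfin
    obtain ⟨C, hC⟩ := Finite.exists_infinite_fiber (Set.rangeFactorization g)
    have hC' : (Set.rangeFactorization g ⁻¹' {C}).Infinite := Set.infinite_coe_iff.1 hC
    let φ := hC'.natEmbedding
    have hφ : ∀ i, g (φ i) = C := fun i => congrArg Subtype.val (φ i).2
    refine HasConnectedRays.infinitePacking
      ⟨fun i => r (φ i), fun i => hr _, fun i j m n hij => hrr _ _ _ _ ?_, fun i j => ?_⟩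
    · exact fun h => hij (φ.injective (Subtype.ext h))
    · exact SimpleGraph.ConnectedComponent.exact ((hφ i).trans (hφ j).symm)
  -- With infinitely many components, one double ray from each suffices.
  · let φ := Set.Infinite.natEmbedding _ hfin
    choose ψ hψ using fun i => (φ i).2
    choose f hf hfr using hD
    refine ⟨fun i => f (ψ i), fun i => hf _, fun i j hij => disjoint_iff_adj.2 fun a b h h' => ?_⟩
    have key : ∀ k, (trace (f (ψ k))).Adj a b → G.Reachable (r (ψ k) 0) a := by
      intro k hk
      obtain ⟨m, hm⟩ := hfr (ψ k)
      obtain ⟨n, hn⟩ := mem_range_of_trace_adj (hf (ψ k)).inj hk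
      rw [← hm, ← hn]
      exact (hf _).reachable m n
    have : g (ψ i) = g (ψ j) :=
      SimpleGraph.ConnectedComponent.sound ((key i h).trans (key j h').symm)
    rw [hψ, hψ] at this
    exact hij (φ.injective (Subtype.ext this))

theorem infinitePacking_of_packings {G : SimpleGraph V}
    (hG : ∀ k : ℕ, ∃ f : Fin k → ℤ → V, (∀ i, IsDoubleRay G (f i)) ∧
      ∀ i j, i ≠ j → Disjoint (trace (f i)) (trace (f j))) : InfinitePacking G := by
  classical
  choose f hf hff using hG
  let X : (Σ k : ℕ, Fin k) → ℤ → V := fun p => f p.1 p.2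
  obtain ⟨H, hH, hX, hHX⟩ := exists_locallyFinite (X := X) fun p => (hf p.1 p.2).inj
  by_cases hd : ∃ d, ∀ W : Finset V, ∃ U, W ⊆ U ∧ (boundary H U).ncard ≤ d
  · obtain ⟨d, hd⟩ := hd
    have hfin : ∀ n, ((fun p : (Σ k : ℕ, Fin k) × ℤ => X p.1 p.2) ''
        {p | Encodable.encode p ≤ n}).Finite := fun n => (finite_encode_le n).image _
    refine infinitePacking_of_boundary hH hd
      (fun k => ⟨f k, hf k, hff k, fun i => hX ⟨k, i⟩⟩)
      (W := fun n => (hfin n).toFinset) (fun m n hmn => ?_) fun v b hvb => ?_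
    · exact Set.Finite.toFinset_mono (Set.image_mono fun p hp => le_trans hp hmn)
    · obtain ⟨j, hj⟩ := hHX v b hvb
      obtain ⟨n, rfl⟩ := mem_range_of_trace_adj (hf j.1 j.2).inj hj
      exact ⟨Encodable.encode (j, n), (Set.Finite.mem_toFinset _).2 ⟨(j, n),
        show Encodable.encode (j, n) ≤ Encodable.encode (j, n) from le_rfl, rfl⟩⟩
  · push Not at hd
    obtain ⟨r, hr, hrr⟩ := exists_disjoint_rays_of_boundary hH hd
    have hHG : H ≤ G := fun a b hab => by
      obtain ⟨j, hj⟩ := hHX a b hab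
      exact (hf j.1 j.2).trace_le hj
    refine infinitePacking_of_disjoint_rays (fun i => (hr i).mono hHG) hrr fun i => ?_
    obtain ⟨j, hj⟩ := hHX _ _ ((hr i).adj 0)
    exact ⟨X j, hf j.1 j.2, mem_range_of_trace_adj (hf j.1 j.2).inj hj⟩

end EdgeDisjointDoubleRays

theorem theorem1 {V : Type*} (G : SimpleGraph V)
    (hG : G.HasArbitrarilyManyEdgeDisjoint doubleRay) :
    G.HasInfinitelyManyEdgeDisjoint doubleRay := by
  exact (EdgeDisjointDoubleRays.infinitePacking_of_packings
    (EdgeDisjointDoubleRays.exists_packing hG)).hasInfinitelyMany
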